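/- **Setting.** Let $m,n\ge 1$. Nodes $1,\dots,m$ are joined by a connected undirected graph with neighbour sets $N_i\subseteq[m]$ (loops permitted), $m_i=|N_i|$. Let $B\in\mathbb R^{m\times m}$, $B_{ji}=1/m_i$ if $j\in N_i$ and $B_{ji}=0$ otherwise, let $\lambda_1(B)\ge\dots\ge\lambda_m(B)$ be its eigenvalues, and assume that $B$ is doubly stochastic with $\zeta:=\max\{|\lambda_2(B)|,|\lambda_m(B)|\}<1$. Node $i$ has a finite dataset $\mathcal D_i$ and, for every batch $b\subseteq\mathcal D_i$, a continuously differentiable loss $f_i(\cdot;b):\mathbb R^n\to\mathbb R$, with $f_i(\cdot;\emptyset)=0$; $f_i:=f_i(\cdot;\mathcal D_i)$ is bounded from below, and $f:=\sum_i f_i$. For some $\delta>0$, $\alpha_i>0$, the gradient $\nabla f_i$ is $\alpha_i$-Lipschitz on $\mathbb N(2\delta)$, where $\mathbb N(r):=\{x:\|x\|_\infty\le r\}$. Put $\varepsilon_i:=\sup\{\|\nabla f_i(x;b)-\nabla f_i(x;b')\|_\infty:\ b,b'\subseteq\mathcal D_i,\ x\in\mathbb N(2\delta)\}$. **Algorithm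 (PaME).** Let $k_0\ge1$, $\nu_i\in(0,1]$, $t_i=\lfloor\nu_i m_i\rfloor$, $0<s<n$, $p=s/n$, $\gamma>1$, $\sigma^k=\gamma^k\sigma^0$ and $w_i^0=0$. If $k_0\mid k$, node $i$ selects a uniformly random $t_i$-element set $N_i^k\subseteq N_i$; each $j\in N_i^k$ sends to $i$ the coordinates of $w_j^k$ in a uniformly random $s$-element set $T_j^k\subseteq[n]$, the sets of different senders $j$ being independent of each other and of $N_i^k$; for each $\ell\in[n]$, $\overline v_{i\ell}^k$ is the average of $w_{j\ell}^k$ over the $j\in N_i^k$ with $\ell\in T_j^k$, and $\overline v_{i\ell}^k=w_{i\ell}^k$ if there is no such $j$. (The sets that $j$ sends to different receivers may be equal, or depend on each other in any way.) If $k_0\nmid k$, $\overline v_i^k=w_i^k$. Then $$w_i^{k+1}=\overline v_i^k-\frac{1}{\sigma^k t_i}\nabla f_i(\overline v_i^k;\mathcal B_i^k)$$ with an arbitrary random batch $\mathcal B_i^k\subseteq\mathcal D_i$. The selections of neighbours and coordinates at a communication are independent of all random choices of earlier iterations. **Parameters.** With $0/0:=0$ let $$c_i=\sum_{r=1}^{t_i}\binom{t_i}{r}p^r(1-p)^{t_i-r}\frac{t_i-r}{r(t_i-1)},\qquad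 \xi_i=\frac{(1-(1-p)^{t_i})(m_i-t_i)}{m_it_i(m_i-1)}.$$ Assume $\zeta<\gamma^{-k_0/2}$ and, for all $i$, $$(1-p)^{t_i}(1+\zeta)^2+\sum_{j\in N_i}\Big(\frac{c_j}{m_j}+\xi_j\Big)<\big(\gamma^{-k_0/2}-\zeta\big)^2 ,$$ and $$\sigma^0\ \ge\ \max\Big\{4\max_i\alpha_i,\ \frac{\gamma\,\max_i\varepsilon_i}{(\gamma-1)\,\delta\,\min_i t_i}\Big\}.$$ **Claim.** Put $\varpi^k=\frac1m\sum_i w_i^k$, $W^k=(w_1^k,\dots,w_m^k)$, $V^k=(\overline v_1^k,\dots,\overline v_m^k)$, $H^k=\mathbb E\sum_i\big(f_i(w_i^k)+\frac{\sigma^kt_i}{2}\|w_i^k-\overline v_i^k\|^2\big)$ and $\widetilde H^k=H^k+C\gamma^{-k}+D\eta^{-k}$, with any constants $C,D$ and $\eta>1$. All expectations below are those of integrable random variables, and: 1. for every $i$, $\ \lim_k\mathbb E\|w_i^{k}-w_i^{k-1}\|=\lim_k\mathbb E\|\overline v_i^{k}-\overline v_i^{k-1}\|=\lim_k\mathbb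 E\|w_i^k-\overline v_i^k\|=0$; 2. there is a square-integrable random vector $\varpi^\infty$ with $\mathbb E\|\varpi^k-\varpi^\infty\|^2\to0$ and $\mathbb E\varpi^k\to\mathbb E\varpi^\infty$, and $\lim_k\mathbb EW^k=\lim_k\mathbb EV^k=(\mathbb E\varpi^\infty,\dots,\mathbb E\varpi^\infty)$; 3. $\lim_k\widetilde H^k=\lim_kH^k=\lim_k\mathbb Ef(\varpi^k)=\mathbb Ef(\varpi^\infty)$. -/

import Mathlib

open MeasureTheory ProbabilityTheory Filter Topology

noncomputable section

namespace DFL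

/-- The parameter space `ℝⁿ` with its Euclidean norm. -/
abbrev Vec (n : ℕ) := EuclideanSpace ℝ (Fin n)

/-- The supremum norm of a vector of `ℝⁿ`. -/
def supNorm {n : ℕ} (w : Vec n) : ℝ := ‖WithLp.ofLp w‖

/-- The box `{w : ‖w‖_∞ ≤ r}`. -/
def box (n : ℕ) (r : ℝ) : Set (Vec n) := {w | supNorm w ≤ r}

/-! ### The network -/

/-- `B j i = 1 / |N_i|` if `j ∈ N_i`, and `0` otherwise. -/
def commMatrix {m : ℕ} (N : Fin m → Finset (Fin m)) : Matrix (Fin m) (Fin m) ℝ :=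
  Matrix.of fun j i => if j ∈ N i then 1 / ((N i).card : ℝ) else 0

/-- The real eigenvalues of `B`, with multiplicity, in decreasing order: entry `i` is the
`(i+1)`-st largest eigenvalue. -/
def eigenvalueDesc {m : ℕ} (B : Matrix (Fin m) (Fin m) ℝ) (i : ℕ) : ℝ :=
  (B.charpoly.roots.sort (· ≥ ·)).getD i 0

/-- `ζ(B) = max {|λ₂(B)|, |λ_m(B)|}`. -/
def zeta {m : ℕ} (B : Matrix (Fin m) (Fin m) ℝ) : ℝ :=
  max |eigenvalueDesc B 1| |eigenvalueDesc B (m - 1)|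

/-- The neighbour sets describe a connected undirected graph (loops are permitted). -/
structure IsNetwork {m : ℕ} (N : Fin m → Finset (Fin m)) : Prop where
  symm : ∀ i j, j ∈ N i → i ∈ N j
  connected : (SimpleGraph.fromRel fun i j => j ∈ N i).Connected

/-- The communication matrix is doubly stochastic, with `ζ < 1`. -/
structure IsMixing {m : ℕ} (N : Fin m → Finset (Fin m)) : Prop where
  doublyStochastic : commMatrix N ∈ doublyStochastic ℝ (Fin m)
  zeta_lt_one : zeta (commMatrix N) < 1

/-! ### Partial message exchange -/

/-- The sparse message: the coordinates in `T` of `w`, and zeros elsewhere. -/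
def sparse {n : ℕ} (w : Vec n) (T : Finset (Fin n)) : Vec n :=
  WithLp.toLp 2 fun l => if l ∈ T then w l else 0

/-- Node `i` averages, coordinate by coordinate, the messages of the nodes of `S` that really
transmitted this coordinate (a transmitted zero counts as transmitted), and keeps its own
coordinate if there are none. -/
def pme {m n : ℕ} (W : Fin m → Vec n) (i : Fin m) (S : Finset (Fin m))
    (T : Fin m → Finset (Fin n)) : Vec n :=
  WithLp.toLp 2 fun l =>
    if (S.filter fun j => l ∈ T j).card = 0 then W i l
    else (∑ j ∈ S, sparse (W j) (T j) l) / ((S.filter fun j => l ∈ T j).card : ℝ)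

/-! ### The algorithm -/

/-- The data of a run of the algorithm with `m` nodes and `n` parameters: node `i` has the
dataset `D i`, and the random choices live on `Ω`. -/
structure PaME (m n : ℕ) (D : Fin m → Type*) (Ω : Type*) where
  /-- `loss i b` is the loss of node `i` on the batch `b`. -/
  loss : (i : Fin m) → Finset (D i) → Vec n → ℝ
  /-- The neighbour sets. -/
  nbhd : Fin m → Finset (Fin m)
  /-- The communication periods. -/
  period : Fin m → ℕ
  /-- The initial penalties. -/
  penalty₀ : Fin m → ℝ
  /-- The growth factors of the penalties. -/
  growth : Fin m → ℝ
  /-- The neighbours that node `i` selects at iteration `k` (used if `i` communicates at `k`). -/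
  select : ℕ → Fin m → Ω → Finset (Fin m)
  /-- `coords k i j` is the set of coordinates that `j` transmits to `i` at iteration `k`. -/
  coords : ℕ → Fin m → Fin m → Ω → Finset (Fin n)
  /-- The batch that node `i` samples at iteration `k`. -/
  batch : ℕ → (i : Fin m) → Ω → Finset (D i)

namespace PaME

variable {m n : ℕ} {D : Fin m → Type*} {Ω : Type*}

/-- The penalty `σ_i^k = γ_i^k σ_i^0`. -/
def penalty (A : PaME m n D Ω) (k : ℕ) (i : Fin m) : ℝ := A.growth i ^ k * A.penalty₀ i

/-- `m_i^k`: the number of neighbours selected at the latest communication up to iteration `k`. -/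
def count (A : PaME m n D Ω) (k : ℕ) (i : Fin m) (ω : Ω) : ℕ :=
  (A.select (A.period i * (k / A.period i)) i ω).card

/-- The aggregation step of iteration `k`: node `i` communicates if `k` is a multiple of its
period, and keeps its own parameter otherwise. -/
def aggregate (A : PaME m n D Ω) (k : ℕ) (W : Fin m → Vec n) (i : Fin m) (ω : Ω) : Vec n :=
  if A.period i ∣ k then pme W i (A.select k i ω) (fun j => A.coords k i j ω) else W i

/-- The iterates `w_i^k`, started at `0`. -/
def w (A : PaME m n D Ω) : ℕ → Fin m → Ω → Vec n
  | 0, _, _ => 0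
  | k + 1, i, ω =>
    A.aggregate k (fun j => A.w k j ω) i ω -
      (1 / (A.penalty k i * (A.count k i ω : ℝ))) •
        gradient (A.loss i (A.batch k i ω)) (A.aggregate k (fun j => A.w k j ω) i ω)

/-- The aggregated parameters `v̄_i^k`. -/
def v (A : PaME m n D Ω) (k : ℕ) (i : Fin m) (ω : Ω) : Vec n :=
  A.aggregate k (fun j => A.w k j ω) i ω

/-- The average iterate `ϖ^k`. -/
def avg (A : PaME m n D Ω) (k : ℕ) (ω : Ω) : Vec n := (1 / (m : ℝ)) • ∑ i, A.w k i ω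

/-- The numbers `t_i = ⌊ν_i |N_i|⌋`. -/
def participants (A : PaME m n D Ω) (ν : Fin m → ℝ) (i : Fin m) : ℕ :=
  ⌊ν i * ((A.nbhd i).card : ℝ)⌋₊

/-! ### Losses -/

variable [∀ i, Fintype (D i)]

/-- The local loss `f_i`, on the whole dataset of node `i`. -/
def localLoss (A : PaME m n D Ω) (i : Fin m) : Vec n → ℝ := A.loss i Finset.univ

/-- The global loss `f = ∑ f_i`. -/
def globalLoss (A : PaME m n D Ω) (x : Vec n) : ℝ := ∑ i, A.localLoss i x

/-- Standing assumptions on the losses. All batch losses have continuous gradients, the empty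
batch has loss `0`, and the local losses are bounded from below. -/
structure RegularLosses (A : PaME m n D Ω) : Prop where
  contDiff : ∀ i b, ContDiff ℝ 1 (A.loss i b)
  empty : ∀ i, A.loss i ∅ = 0
  bddBelow : ∀ i, BddBelow (Set.range (A.localLoss i))

/-- `∇f_i` is Lipschitz on the box of radius `2δ`, with constant `α_i > 0`. -/
structure LipschitzGradients (A : PaME m n D Ω) (α : Fin m → ℝ) (δ : ℝ) : Prop where
  α_pos : ∀ i, 0 < α i
  δ_pos : 0 < δ
  lipschitz : ∀ i, ∀ x ∈ box n (2 * δ), ∀ y ∈ box n (2 * δ),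
    ‖gradient (A.localLoss i) x - gradient (A.localLoss i) y‖ ≤ α i * ‖x - y‖

/-- `ε_i(r)`: the supremum of `‖∇f_i(x; b) - ∇f_i(x; c)‖_∞` over all `x` in the box of radius `r`
and all `b, c ⊆ D_i`. -/
def gradGap (A : PaME m n D Ω) (i : Fin m) (r : ℝ) : ℝ :=
  sSup {e | ∃ b c : Finset (D i), ∃ x ∈ box n r,
    e = supNorm (gradient (A.loss i b) x - gradient (A.loss i c) x)}

/-- `σ = max {4 α_max, ε(2δ) γ / ((γ - 1) δ t_min)}`. -/
def threshold (A : PaME m n D Ω) (α : Fin m → ℝ) (t : Fin m → ℕ) (γ δ : ℝ) : ℝ :=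
  max (4 * ⨆ i, α i)
    ((⨆ i, A.gradGap i (2 * δ)) * γ / ((γ - 1) * δ * ((⨅ i, t i : ℕ) : ℝ)))

/-- The merit function `H^k`. -/
def merit [MeasurableSpace Ω] (A : PaME m n D Ω) (μ : Measure Ω) (t : Fin m → ℕ) (k : ℕ) : ℝ :=
  ∫ ω, ∑ i, (A.localLoss i (A.w k i ω)
    + A.penalty k i * (t i : ℝ) / 2 * ‖A.w k i ω - A.v k i ω‖ ^ 2) ∂μ

/-- The merit function `H̃^k = H^k + C γ^{-k} + E η^{-k}`, with constants `C`, `E` and `η > 1`. -/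
def meritTilde [MeasurableSpace Ω] (A : PaME m n D Ω) (μ : Measure Ω) (t : Fin m → ℕ)
    (γ η C E : ℝ) (k : ℕ) : ℝ :=
  A.merit μ t k + C * (γ ^ k)⁻¹ + E * (η ^ k)⁻¹

end PaME

/-! ### The parameter setup -/

/-- `X` is a uniformly distributed random `t`-element subset of `S`. -/
structure IsUniformSubset {Ω ι : Type*} [MeasurableSpace Ω] (μ : Measure Ω)
    (X : Ω → Finset ι) (S : Finset ι) (t : ℕ) : Prop where
  mem : ∀ ω, X ω ∈ S.powersetCard t
  uniform : ∀ R ∈ S.powersetCard t, μ.real {ω | X ω = R} = 1 / (S.card.choose t : ℝ)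

/-- `c(p, t) = ∑_{r=1}^t C(t, r) p^r (1-p)^{t-r} (t-r) / (r (t-1))`, with `0/0 = 0`. -/
def samplingVar (p : ℝ) (t : ℕ) : ℝ :=
  ∑ r ∈ Finset.Icc 1 t, (t.choose r : ℝ) * p ^ r * (1 - p) ^ (t - r) *
    (((t : ℝ) - r) / ((r : ℝ) * ((t : ℝ) - 1)))

/-- `ξ(p, t, d) = (1 - (1-p)^t) (d-t) / (d t (d-1))`, with `0/0 = 0`. -/
def selectionVar (p : ℝ) (t d : ℕ) : ℝ :=
  (1 - (1 - p) ^ t) * ((d : ℝ) - t) / ((d : ℝ) * t * ((d : ℝ) - 1))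

/-- The choice of the parameters, and the laws of the random selections. The bound `zeta_lt` says
`γ < ζ^{-2/k₀}` (no restriction if `ζ = 0`). In `contraction`, the first term accounts for
coordinates that no selected neighbour transmits, `samplingVar` for the sampling of coordinates and
`selectionVar` for the sampling of neighbours; it forces `t_i ≥ 1`. The batches are arbitrary random subsets of the
datasets. The sets transmitted by `j` to different receivers at the same iteration may depend on
each other in any way; in particular they may be equal. -/
structure Setup {m n : ℕ} {D : Fin m → Type*} {Ω : Type*} [∀ i, Fintype (D i)]
    [MeasurableSpace Ω] (A : PaME m n D Ω) (μ : Measure Ω) (α ν : Fin m → ℝ) (k₀ s : ℕ)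
    (σ₀ γ δ : ℝ) : Prop where
  k₀_pos : 0 < k₀
  period : ∀ i, A.period i = k₀
  penalty₀ : ∀ i, A.penalty₀ i = σ₀
  growth : ∀ i, A.growth i = γ
  ν_mem : ∀ i, ν i ∈ Set.Ioc (0 : ℝ) 1
  s_pos : 0 < s
  s_lt : s < n
  one_lt_γ : 1 < γ
  zeta_lt : zeta (commMatrix A.nbhd) < γ ^ (-(k₀ : ℝ) / 2)
  contraction : ∀ i,
    (1 - (s : ℝ) / n) ^ A.participants ν i * (1 + zeta (commMatrix A.nbhd)) ^ 2
      + ∑ j ∈ A.nbhd i, (samplingVar ((s : ℝ) / n) (A.participants ν j) / ((A.nbhd j).card : ℝ)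
          + selectionVar ((s : ℝ) / n) (A.participants ν j) (A.nbhd j).card)
      < (γ ^ (-(k₀ : ℝ) / 2) - zeta (commMatrix A.nbhd)) ^ 2
  threshold_le : A.threshold α (A.participants ν) γ δ ≤ σ₀
  measurable_select : ∀ k i, Measurable (A.select k i)
  measurable_coords : ∀ k i j, Measurable (A.coords k i j)
  measurable_batch : ∀ k i, Measurable (A.batch k i)
  /-- At a communication, node `i` selects `t_i` of its neighbours uniformly. -/
  select_uniform : ∀ k, k₀ ∣ k → ∀ i,
    IsUniformSubset μ (A.select k i) (A.nbhd i) (A.participants ν i)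
  /-- At a communication, each node transmits `s` uniformly selected coordinates. -/
  coords_uniform : ∀ k, k₀ ∣ k → ∀ i j, IsUniformSubset μ (A.coords k i j) Finset.univ s
  /-- The senders select their coordinates independently. -/
  coords_indep : ∀ k, k₀ ∣ k → ∀ i, iIndepFun (fun j => A.coords k i j) μ
  /-- The selection of coordinates is independent of the selection of neighbours. -/
  select_indep : ∀ k, k₀ ∣ k → ∀ i,
    IndepFun (A.select k i) (fun ω j => A.coords k i j ω) μ
  /-- The selections of a communication are independent of all earlier random choices. -/
  past_indep : ∀ k, k₀ ∣ k → IndepFun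
    (fun ω => ((fun i => A.select k i ω), (fun i j => A.coords k i j ω)))
    (fun ω (l : Fin k) => ((fun i => A.select l i ω), (fun i j => A.coords l i j ω),
      (fun i => A.batch l i ω))) μ

end DFL

end

/-! The proof rests on consensus and boundedness, not on descent of the merit function.

Boundedness. In each coordinate an aggregation is an average of values held by the nodes, so it
never increases the largest sup-norm. A gradient step has sup-norm at most a constant times `γ⁻¹ ^
k`, and the threshold on `σ₀` makes the sum of these bounds at most `δ`. So all iterates stay in one
compact box (`Setup.w_mem_box`), and gradient steps are `O(γ⁻¹ ^ k)` in norm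
(`Setup.exists_step_bound`).

Consensus. Freeze the past at a communication and take one coordinate, centred at the mean. The
second moment of a partial average is bounded by three terms: the node's own square when nothing
arrives, the squared neighbourhood mean, and a sampling variance
(`sum_powersetCard_bernoulliMean_le`). Summed over the nodes, the neighbourhood means contract by `ζ
^ 2` by the spectral gap (`sum_nbhd_mean_sq_le`), and the variances are redistributed by symmetry of
the graph. The expected consensus error is thus multiplied by at most some `ρ < γ⁻¹ ^ k₀`
(`Setup.integral_pme_le`, `Setup.integral_communication_le`). The steps in between perturb it by
only `O(γ⁻¹ ^ (2 * k))`, so it is `O(r ^ k)` with `r < γ⁻¹` (`Setup.exists_integral_spread_le`).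

Limit. Expected distances then decay geometrically and are summable, so almost surely all nodes
converge to a common vector (`Setup.exists_ae_tendsto`). Dominated convergence in the box gives all
limits of expectations. The penalty part of the merit function is `O((γ * r) ^ k)`, which is where
`r < γ⁻¹` rather than `r < 1` is needed (`Setup.tendsto_penalty`). -/

noncomputable section

namespace DFL

/-! ### The communication graph and its spectral gap. -/

section Network

variable {m : ℕ} {N : Fin m → Finset (Fin m)}

theorem IsNetwork.mem_comm (h : IsNetwork N) (i j : Fin m) : j ∈ N i ↔ i ∈ N j :=
  ⟨h.symm i j, h.symm j i⟩

theorem IsNetwork.sum_swap (h : IsNetwork N) (F : Fin m → Fin m → ℝ) :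
    ∑ i, ∑ j ∈ N i, F i j = ∑ j, ∑ i ∈ N j, F i j := by
  refine Finset.sum_comm' fun i j => ?_
  simp [h.mem_comm i j]

/-- This is the row sum of `B`. Columns sum to one by construction, so the rows carry the
information in double stochasticity. -/
theorem sum_inv_card_of_doublyStochastic (h : IsNetwork N)
    (hB : commMatrix N ∈ doublyStochastic ℝ (Fin m)) (j : Fin m) :
    ∑ i ∈ N j, 1 / ((N i).card : ℝ) = 1 := by
  have h1 := congrFun hB.2.1 j
  simp only [Matrix.mulVec, dotProduct, commMatrix, Matrix.of_apply, Pi.one_apply, mul_one] at h1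
  refine Eq.trans ?_ h1
  rw [← Finset.sum_filter]
  refine Finset.sum_congr ?_ fun _ _ => rfl
  ext i
  simp [h.mem_comm i j]

theorem card_pos_of_doublyStochastic
    (hB : commMatrix N ∈ doublyStochastic ℝ (Fin m)) (i : Fin m) : 0 < (N i).card := by
  have h1 := congrFun hB.2.2 i
  by_contra h0
  have h2 : N i = ∅ := by simpa using h0
  simp [Matrix.vecMul, dotProduct, commMatrix, h2] at h1

/-- A connected network with doubly stochastic communication matrix is regular. -/
theorem card_eq_of_doublyStochastic (h : IsNetwork N)
    (hB : commMatrix N ∈ doublyStochastic ℝ (Fin m)) (i j : Fin m) : (N i).card = (N j).card := by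
  -- The reciprocal degrees are harmonic: the neighbours' values sum to `1`, and so do `|N j|`
  -- copies of `x j`.
  set x : Fin m → ℝ := fun i => 1 / ((N i).card : ℝ) with hx
  have hpos : ∀ i, (0 : ℝ) < (N i).card := fun i => by
    exact_mod_cast card_pos_of_doublyStochastic hB i
  have hharm : ∀ j, ∑ i ∈ N j, (x j - x i) = 0 := fun j => by
    rw [Finset.sum_sub_distrib, sum_inv_card_of_doublyStochastic h hB j]
    simp [hx, (hpos j).ne']
  -- The Dirichlet energy of a harmonic function vanishes by summation by parts, so `x` is constant
  -- along edges.
  have hzero : ∑ j, ∑ i ∈ N j, (x j - x i) ^ 2 = 0 := by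
    have h1 : ∑ j, ∑ i ∈ N j, x j * (x j - x i) = 0 := by
      simp [← Finset.mul_sum, hharm]
    have h2 := h1
    rw [h.sum_swap] at h2
    have h3 : ∑ j, ∑ i ∈ N j, (x j - x i) ^ 2
        = ∑ j, ∑ i ∈ N j, x j * (x j - x i) + ∑ j, ∑ i ∈ N j, x i * (x i - x j) := by
      rw [← Finset.sum_add_distrib]
      refine Finset.sum_congr rfl fun j _ => ?_
      rw [← Finset.sum_add_distrib]
      exact Finset.sum_congr rfl fun i _ => by ring
    rw [h3, h1, h2, add_zero]
  have hadj : ∀ j, ∀ i ∈ N j, x j = x i := fun j i hi => by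
    rw [Finset.sum_eq_zero_iff_of_nonneg fun j _ =>
      Finset.sum_nonneg fun i _ => sq_nonneg _] at hzero
    have h4 := hzero j (Finset.mem_univ j)
    rw [Finset.sum_eq_zero_iff_of_nonneg fun i _ => sq_nonneg _] at h4
    have := pow_eq_zero_iff (two_ne_zero) |>.1 (h4 i hi)
    linarith
  have hconst : ∀ i j, x i = x j := by
    intro i j
    obtain ⟨p⟩ := h.connected.preconnected i j
    induction p with
    | nil => rfl
    | cons hab _ ih =>
      refine Eq.trans ?_ ih
      rw [SimpleGraph.fromRel_adj] at hab
      rcases hab.2 with h' | h'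
      · exact hadj _ _ h'
      · exact (hadj _ _ h').symm
  have := hconst i j
  simp only [hx, one_div, inv_inj] at this
  exact_mod_cast this

theorem commMatrix_isSymm (h : IsNetwork N)
    (hB : commMatrix N ∈ doublyStochastic ℝ (Fin m)) : (commMatrix N).IsSymm := by
  ext i j
  simp only [Matrix.transpose_apply, commMatrix, Matrix.of_apply]
  rw [card_eq_of_doublyStochastic h hB i j]
  simp only [h.mem_comm i j]

theorem zeta_nonneg (B : Matrix (Fin m) (Fin m) ℝ) : 0 ≤ zeta B :=
  le_max_of_le_left (abs_nonneg _)

/-- On vectors with mean zero, a symmetric matrix with unit row sums contracts by `ζ`. -/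
theorem sum_mulVec_sq_le {B : Matrix (Fin m) (Fin m) ℝ} (hB : B.IsSymm)
    (hone : B.mulVec 1 = 1) (hz : zeta B < 1) (u : Fin m → ℝ) (hu : ∑ i, u i = 0) :
    ∑ i, (B.mulVec u i) ^ 2 ≤ zeta B ^ 2 * ∑ i, u i ^ 2 := by
  have hH : B.IsHermitian := by
    rw [Matrix.IsHermitian, Matrix.conjTranspose_eq_transpose_of_trivial]; exact hB
  set T := Matrix.toLpLin 2 2 B with hT
  have hsym : T.IsSymmetric := Matrix.isSymmetric_toEuclideanLin_iff.2 hH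
  have hfin : Module.finrank ℝ (EuclideanSpace ℝ (Fin m)) = m := by simp
  have hchar : T.charpoly = B.charpoly := by
    rw [hT, Matrix.toLpLin_eq_toLin, ← LinearMap.charpoly_toMatrix _
      (PiLp.basisFun 2 ℝ (Fin m)), LinearMap.toMatrix_toLin]
  set ev := hsym.eigenvalues hfin with hev
  set b := hsym.eigenvectorBasis hfin with hb
  have hsort : B.charpoly.roots.sort (· ≥ ·) = List.ofFn ev := by
    have := hsym.sort_roots_charpoly_eq_eigenvalues hfin
    rw [hchar] at this
    simpa using this
  have hget : ∀ i : Fin m, eigenvalueDesc B i = ev i := fun i => by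
    rw [eigenvalueDesc, hsort]
    simp
  have hanti : Antitone ev := hsym.eigenvalues_antitone hfin
  have hTb : ∀ j, T (b j) = ev j • b j := fun j =>
    hsym.apply_eigenvectorBasis hfin j
  have hbound : ∀ j : Fin m, j.val ≠ 0 → |ev j| ≤ zeta B := by
    intro j hj
    -- A nonzero index forces two nodes, so neither entry read by `zeta` is the default `0` of the
    -- sorted list.
    have h1 : 1 < m := by have := j.2; omega
    have e1 := hget ⟨1, h1⟩
    have e2 := hget ⟨m - 1, by omega⟩
    simp only at e1 e2
    rw [zeta, e1, e2]
    have a1 : ev j ≤ ev ⟨1, h1⟩ := hanti (by rw [Fin.le_def]; simp; omega)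
    have a2 : ev ⟨m - 1, by omega⟩ ≤ ev j := hanti (by rw [Fin.le_def]; simp; omega)
    rw [abs_le]
    constructor
    · have := neg_abs_le (ev ⟨m - 1, by omega⟩)
      have := le_max_right |ev ⟨1, h1⟩| |ev ⟨m - 1, by omega⟩|
      linarith
    · exact (a1.trans (le_abs_self _)).trans (le_max_left _ _)
  set o : EuclideanSpace ℝ (Fin m) := WithLp.toLp 2 1 with ho
  set U : EuclideanSpace ℝ (Fin m) := WithLp.toLp 2 u with hU
  have hTo : T o = o := by
    rw [hT, ho, Matrix.toLpLin_toLp]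
    simp [Matrix.toLin'_apply, hone]
  -- Since `ζ < 1`, only the top eigenvalue can equal `1`. Hence the all-ones vector is a multiple
  -- of the top eigenvector, and vectors of mean zero have no component along it.
  have horth : ∀ j : Fin m, j.val ≠ 0 → inner ℝ (b j) o = 0 := by
    intro j hj
    have h1 : inner ℝ (T (b j)) o = inner ℝ (b j) (T o) := hsym _ _
    rw [hTb, hTo, inner_smul_left] at h1
    simp only [conj_trivial] at h1
    have h2 : ev j ≠ 1 := by
      have := (le_abs_self _).trans (hbound j hj)
      linarith
    have h3 : (ev j - 1) * inner ℝ (b j) o = 0 := by linarith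
    exact (mul_eq_zero.1 h3).resolve_left (sub_ne_zero.2 h2)
  have hUo : inner ℝ o U = 0 := by
    simp [ho, hU, PiLp.inner_apply, hu]
  have hU0 : ∀ j : Fin m, j.val = 0 → inner ℝ (b j) U = 0 := by
    intro j hj
    have ho0 : o ≠ 0 := by
      intro h0
      have := congrArg (fun v : EuclideanSpace ℝ (Fin m) => v j) h0
      simp [ho] at this
    have hoj : o = inner ℝ (b j) o • b j := by
      conv_lhs => rw [← b.sum_repr' o]
      refine Finset.sum_eq_single j (fun i _ hi => ?_) (by simp)
      rw [horth i (fun h => hi (Fin.ext (by omega))), zero_smul]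
    have hne : inner ℝ (b j) o ≠ 0 := fun h0 => ho0 (by rw [hoj, h0, zero_smul])
    have h4 := hUo
    rw [hoj, inner_smul_left] at h4
    simpa [hne] using h4
  have hnorm : ∀ v : EuclideanSpace ℝ (Fin m), ∑ i, v i ^ 2 = ∑ j, (inner ℝ (b j) v) ^ 2 := by
    intro v
    have h1 := b.sum_sq_norm_inner_right v
    have h2 := EuclideanSpace.real_norm_sq_eq v
    rw [← h2, ← h1]
    simp
  have hTU : ∀ i, B.mulVec u i = (T U) i := fun i => by
    rw [hT, hU, Matrix.toLpLin_toLp]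
    simp
  have hUi : ∀ i, u i = U i := fun i => rfl
  simp_rw [hTU, hUi]
  rw [hnorm, hnorm, Finset.mul_sum]
  refine Finset.sum_le_sum fun j _ => ?_
  have h5 : inner ℝ (b j) (T U) = ev j * inner ℝ (b j) U := by
    rw [← hsym, hTb, inner_smul_left]; simp
  rw [h5, mul_pow]
  by_cases hj : j.val = 0
  · rw [hU0 j hj]; simp
  · have := sq_le_sq' (by have := neg_abs_le (ev j); linarith [hbound j hj])
      ((le_abs_self _).trans (hbound j hj))
    exact mul_le_mul_of_nonneg_right this (sq_nonneg _)

/-- Averaging over the neighbours contracts vectors with mean zero by `ζ`. -/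
theorem sum_nbhd_mean_sq_le (h : IsNetwork N) (hM : IsMixing N) (u : Fin m → ℝ)
    (hu : ∑ i, u i = 0) :
    ∑ i, ((∑ j ∈ N i, u j) / ((N i).card : ℝ)) ^ 2
      ≤ zeta (commMatrix N) ^ 2 * ∑ i, u i ^ 2 := by
  have hs := commMatrix_isSymm h hM.doublyStochastic
  refine le_trans (le_of_eq ?_)
    (sum_mulVec_sq_le hs hM.doublyStochastic.2.1 hM.zeta_lt_one u hu)
  refine Finset.sum_congr rfl fun i _ => ?_
  congr 1
  rw [← hs]
  simp only [Matrix.mulVec, dotProduct, Matrix.transpose_apply, commMatrix, Matrix.of_apply,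
    ite_mul, zero_mul, Finset.sum_ite_mem, Finset.univ_inter]
  rw [Finset.sum_div]
  exact Finset.sum_congr rfl fun j _ => by ring

end Network

/-! ### Moments of averages over random subsets. -/

section Subsets

variable {ι : Type*} [DecidableEq ι]

/-- Double counting of the pairs `j ∈ R`. With `F = 1` it yields the first moment of a subset sum,
with `F R = ∑ j ∈ R, x j` the second. -/
theorem sum_powersetCard_sum_mul (S : Finset ι) (x : ι → ℝ) (F : Finset ι → ℝ) (r : ℕ) :
    ∑ R ∈ S.powersetCard (r + 1), (∑ j ∈ R, x j) * F R
      = ∑ j ∈ S, x j * ∑ R ∈ (S.erase j).powersetCard r, F (insert j R) := by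
  have h1 : ∀ j ∈ S, ∑ R ∈ (S.erase j).powersetCard r, F (insert j R)
      = ∑ R ∈ (S.powersetCard (r + 1)).filter (j ∈ ·), F R := by
    intro j hj
    refine Finset.sum_bij' (fun R _ => insert j R) (fun R _ => R.erase j) ?_ ?_ ?_ ?_ ?_
    · intro R hR
      rw [Finset.mem_powersetCard] at hR
      have hjR : j ∉ R := fun h => by simpa using hR.1 h
      simp only [Finset.mem_filter, Finset.mem_powersetCard, Finset.mem_insert_self, and_true]
      refine ⟨Finset.insert_subset hj (hR.1.trans (Finset.erase_subset _ _)), ?_⟩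
      rw [Finset.card_insert_of_notMem hjR, hR.2]
    · intro R hR
      simp only [Finset.mem_filter, Finset.mem_powersetCard] at hR
      rw [Finset.mem_powersetCard]
      refine ⟨Finset.erase_subset_erase _ hR.1.1, ?_⟩
      rw [Finset.card_erase_of_mem hR.2, hR.1.2, Nat.add_sub_cancel]
    · intro R hR
      rw [Finset.mem_powersetCard] at hR
      exact Finset.erase_insert fun h => by simpa using hR.1 h
    · intro R hR
      exact Finset.insert_erase (Finset.mem_filter.1 hR).2
    · intro R _
      rfl
  have h2 : ∑ j ∈ S, x j * ∑ R ∈ (S.erase j).powersetCard r, F (insert j R)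
      = ∑ j ∈ S, x j * ∑ R ∈ (S.powersetCard (r + 1)).filter (j ∈ ·), F R :=
    Finset.sum_congr rfl fun j hj => by rw [h1 j hj]
  rw [h2]
  simp_rw [Finset.sum_mul, Finset.mul_sum, Finset.sum_filter]
  rw [Finset.sum_comm]
  refine Finset.sum_congr rfl fun R hR => ?_
  rw [Finset.mem_powersetCard] at hR
  rw [← Finset.sum_filter, Finset.filter_mem_eq_inter, Finset.inter_eq_right.2 hR.1]

theorem card_mul_sum_powersetCard_sum (S : Finset ι) (x : ι → ℝ) (r : ℕ) :
    (S.card : ℝ) * ∑ R ∈ S.powersetCard r, ∑ j ∈ R, x j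
      = r * (S.card.choose r : ℝ) * ∑ j ∈ S, x j := by
  cases r with
  | zero => simp
  | succ r =>
    have h := sum_powersetCard_sum_mul S x (fun _ => 1) r
    simp only [mul_one, Finset.sum_const, Finset.card_powersetCard, nsmul_eq_mul] at h
    rw [h, Finset.sum_congr rfl fun j hj => by rw [Finset.card_erase_of_mem hj],
      ← Finset.sum_mul]
    rcases Nat.eq_zero_or_pos S.card with h0 | h0
    · simp [h0]
    · obtain ⟨t, ht⟩ := Nat.exists_eq_add_of_lt h0
      simp only [zero_add] at ht
      rw [ht, Nat.add_sub_cancel]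
      have h2 := Nat.add_one_mul_choose_eq t r
      have h3 : ((t + 1 : ℕ) : ℝ) * (t.choose r : ℝ) = ((t + 1).choose (r + 1) : ℝ) * (r + 1 : ℕ) := by
        exact_mod_cast h2
      linear_combination (∑ j ∈ S, x j) * h3

/-- Once `j` is removed, what remains ranges over the `r`-subsets of a `t`-element set, where the
first-moment identity applies. The factor `t` on the left avoids a division. -/
theorem sum_powersetCard_sum_sq (S : Finset ι) (x : ι → ℝ) (t r : ℕ) (hS : S.card = t + 1) :
    (t : ℝ) * ∑ R ∈ S.powersetCard (r + 1), (∑ j ∈ R, x j) ^ 2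
      = (t.choose r : ℝ) * ((t - r) * ∑ j ∈ S, x j ^ 2 + r * (∑ j ∈ S, x j) ^ 2) := by
  simp_rw [sq (∑ j ∈ _, x j)]
  rw [sum_powersetCard_sum_mul, Finset.mul_sum]
  have h : ∀ j ∈ S, (t : ℝ) * (x j * ∑ R ∈ (S.erase j).powersetCard r, ∑ k ∈ insert j R, x k)
      = (t.choose r : ℝ) * ((t - r) * x j ^ 2 + r * (x j * ∑ k ∈ S, x k)) := by
    intro j hj
    have hc : (S.erase j).card = t := by rw [Finset.card_erase_of_mem hj, hS, Nat.add_sub_cancel]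
    have h1 := card_mul_sum_powersetCard_sum (S.erase j) x r
    rw [hc] at h1
    have h2 : ∑ R ∈ (S.erase j).powersetCard r, ∑ k ∈ insert j R, x k
        = (t.choose r : ℝ) * x j + ∑ R ∈ (S.erase j).powersetCard r, ∑ k ∈ R, x k := by
      rw [Finset.sum_congr rfl fun R hR => Finset.sum_insert fun h => by
        simpa using (Finset.mem_powersetCard.1 hR).1 h, Finset.sum_add_distrib]
      simp [Finset.card_powersetCard, hc]
    have h3 := Finset.add_sum_erase S x hj
    rw [h2, ← h3]
    linear_combination x j * h1
  rw [Finset.sum_congr rfl h, ← Finset.mul_sum, Finset.sum_add_distrib, ← Finset.mul_sum,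
    ← Finset.mul_sum, ← Finset.sum_mul]

/-- The mean square of the mean of a uniformly random `r`-element subset. -/
theorem sum_powersetCard_mean_sq_le (S : Finset ι) (x : ι → ℝ) {r : ℕ} (hr : 1 ≤ r)
    (hrS : r ≤ S.card) :
    ∑ R ∈ S.powersetCard r, ((∑ j ∈ R, x j) / (r : ℝ)) ^ 2
      ≤ (S.card.choose r : ℝ) * (((S.card : ℝ) - r) / (r * ((S.card : ℝ) - 1))
          * ((∑ j ∈ S, x j ^ 2) / (S.card : ℝ)) + ((∑ j ∈ S, x j) / (S.card : ℝ)) ^ 2) := by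
  obtain ⟨r, rfl⟩ := Nat.exists_eq_add_of_le' hr
  obtain ⟨t, ht⟩ := Nat.exists_eq_add_of_le' (hr.trans hrS)
  have h1 := sum_powersetCard_sum_sq S x t r ht
  have hrt : r ≤ t := by omega
  have h3 : ((t + 1 : ℕ) : ℝ) * (t.choose r : ℝ) = ((t + 1).choose (r + 1) : ℝ) * (r + 1 : ℕ) := by
    exact_mod_cast Nat.add_one_mul_choose_eq t r
  simp_rw [div_pow]
  rw [← Finset.sum_div, ht]
  set Q := ∑ j ∈ S, x j ^ 2
  set M := ∑ j ∈ S, x j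
  have hM : 0 ≤ M ^ 2 := sq_nonneg M
  -- Here `t` is `|S| - 1`. For a one-element set the convention `0/0 = 0` removes the variance term
  -- and both sides agree.
  rcases Nat.eq_zero_or_pos t with h0 | h0
  · subst h0
    obtain rfl : r = 0 := by omega
    have : S.powersetCard 1 = {S} := by
      have := Finset.powersetCard_self S
      rwa [ht] at this
    simp [this, M]
  have ht' : (0 : ℝ) < t := by exact_mod_cast h0
  have hrt' : (r : ℝ) ≤ t := by exact_mod_cast hrt
  have hc : (0 : ℝ) ≤ t.choose r := by positivity
  have e1 : ∑ R ∈ S.powersetCard (r + 1), (∑ j ∈ R, x j) ^ 2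
      = (t.choose r : ℝ) * ((t - r) * Q + r * M ^ 2) / t := by
    rw [← h1]; field_simp
  have e2 : ((t + 1).choose (r + 1) : ℝ) = (t + 1) * (t.choose r : ℝ) / (r + 1) := by
    push_cast at h3
    field_simp
    linarith
  rw [e1, e2]
  push_cast
  rw [← sub_nonneg]
  -- The only loss is in the coefficient of the squared mean, which is at most `1` and is replaced
  -- by `1`.
  have key : (t + 1) * (t.choose r : ℝ) / (r + 1) *
        ((t + 1 - (r + 1)) / ((r + 1) * (t + 1 - 1)) * (Q / (t + 1)) + M ^ 2 / (t + 1) ^ 2)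
      - (t.choose r : ℝ) * ((t - r) * Q + r * M ^ 2) / t / (r + 1) ^ 2
      = (t.choose r : ℝ) * M ^ 2 * (t - r) / (t * (t + 1) * (r + 1) ^ 2) := by
    have : (t + 1 - 1 : ℝ) = t := by ring
    rw [this]
    field_simp
    ring
  rw [key]
  have : (0 : ℝ) ≤ t - r := by linarith
  positivity

/-- The expectation of `g R` for the random subset `R` of `S` that contains every element of `S`
independently with probability `p`. -/
def bernoulliMean (p : ℝ) (S : Finset ι) (g : Finset ι → ℝ) : ℝ :=
  ∑ R ∈ S.powerset, p ^ R.card * (1 - p) ^ (S.card - R.card) * g R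

/-- Conditioned on its size, a Bernoulli subset is uniform, so the bound for fixed size is averaged
with binomial weights. The empty set takes weight `(1 - p) ^ |S|` and leaves the complement for the
squared mean. -/
theorem bernoulliMean_mean_sq_le {p : ℝ} (hp0 : 0 ≤ p) (hp1 : p ≤ 1) (S : Finset ι) (x : ι → ℝ)
    (y : ℝ) :
    bernoulliMean p S (fun R => if R.card = 0 then y else ((∑ j ∈ R, x j) / (R.card : ℝ)) ^ 2)
      ≤ (1 - p) ^ S.card * y + samplingVar p S.card * ((∑ j ∈ S, x j ^ 2) / (S.card : ℝ))
        + (1 - (1 - p) ^ S.card) * ((∑ j ∈ S, x j) / (S.card : ℝ)) ^ 2 := by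
  have hq : 0 ≤ 1 - p := by linarith
  set t := S.card with ht
  set Q := (∑ j ∈ S, x j ^ 2) / (t : ℝ)
  set M := ((∑ j ∈ S, x j) / (t : ℝ)) ^ 2
  have hbin : ∑ r ∈ Finset.Icc 1 t, (t.choose r : ℝ) * p ^ r * (1 - p) ^ (t - r)
      = 1 - (1 - p) ^ t := by
    have h := add_pow p (1 - p) t
    rw [Finset.sum_range_succ', ] at h
    rw [show p + (1 - p) = 1 by ring, one_pow] at h
    simp only [pow_zero, Nat.sub_zero, Nat.choose_zero_right, Nat.cast_one, mul_one, one_mul] at h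
    rw [Finset.range_eq_Ico, Finset.sum_Ico_add' (fun r => p ^ r * (1 - p) ^ (t - r)
      * (t.choose r : ℝ)) 0 t 1] at h
    rw [← eq_sub_of_add_eq h.symm]
    refine Finset.sum_congr ?_ fun r _ => by ring
    ext r; rw [Finset.mem_Icc, Finset.mem_Ico]; omega
  rw [bernoulliMean, Finset.sum_powerset, ← ht, Finset.sum_range_succ']
  have h0 : ∑ R ∈ S.powersetCard 0, p ^ R.card * (1 - p) ^ (t - R.card) *
      (if R.card = 0 then y else ((∑ j ∈ R, x j) / (R.card : ℝ)) ^ 2) = (1 - p) ^ t * y := by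
    simp
  rw [h0]
  have h1 : ∀ r ∈ Finset.Icc 1 t, ∑ R ∈ S.powersetCard r, p ^ R.card * (1 - p) ^ (t - R.card) *
      (if R.card = 0 then y else ((∑ j ∈ R, x j) / (R.card : ℝ)) ^ 2)
      ≤ (t.choose r : ℝ) * p ^ r * (1 - p) ^ (t - r) * (((t : ℝ) - r) / (r * ((t : ℝ) - 1))) * Q
        + (t.choose r : ℝ) * p ^ r * (1 - p) ^ (t - r) * M := by
    intro r hr
    rw [Finset.mem_Icc] at hr
    have h2 : ∀ R ∈ S.powersetCard r, p ^ R.card * (1 - p) ^ (t - R.card) *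
        (if R.card = 0 then y else ((∑ j ∈ R, x j) / (R.card : ℝ)) ^ 2)
        = p ^ r * (1 - p) ^ (t - r) * ((∑ j ∈ R, x j) / (r : ℝ)) ^ 2 := by
      intro R hR
      rw [(Finset.mem_powersetCard.1 hR).2, if_neg (by omega)]
    rw [Finset.sum_congr rfl h2, ← Finset.mul_sum]
    have h3 := sum_powersetCard_mean_sq_le S x hr.1 hr.2
    rw [← ht] at h3
    calc _ ≤ _ := mul_le_mul_of_nonneg_left h3 (by positivity)
      _ = _ := by ring
  have h4 := Finset.sum_le_sum h1
  rw [Finset.sum_add_distrib, ← Finset.sum_mul, ← Finset.sum_mul, hbin] at h4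
  have h5 : Finset.Icc 1 t = Finset.Ico (0 + 1) (t + 1) := by
    ext r; rw [Finset.mem_Icc, Finset.mem_Ico]; omega
  have h6 := Finset.sum_Ico_add' (fun r => ∑ R ∈ S.powersetCard r,
    p ^ R.card * (1 - p) ^ (t - R.card) *
      (if R.card = 0 then y else ((∑ j ∈ R, x j) / (R.card : ℝ)) ^ 2)) 0 t 1
  rw [← Finset.range_eq_Ico, ← h5] at h6
  rw [h6, samplingVar]
  linarith

theorem samplingVar_nonneg {p : ℝ} (hp0 : 0 ≤ p) (hp1 : p ≤ 1) (t : ℕ) : 0 ≤ samplingVar p t := by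
  refine Finset.sum_nonneg fun r hr => ?_
  rw [Finset.mem_Icc] at hr
  have hq : 0 ≤ 1 - p := by linarith
  have h1 : (r : ℝ) ≤ t := by exact_mod_cast hr.2
  have h2 : (1 : ℝ) ≤ t := by exact_mod_cast hr.1.trans hr.2
  have h3 : (0 : ℝ) ≤ t - r := by linarith
  have h4 : (0 : ℝ) ≤ t - 1 := by linarith
  positivity

theorem selectionVar_nonneg {p : ℝ} (hp0 : 0 ≤ p) (hp1 : p ≤ 1) {t d : ℕ} (htd : t ≤ d) :
    0 ≤ selectionVar p t d := by
  have hq : 0 ≤ 1 - p := by linarith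
  have hq1 : (1 - p) ^ t ≤ 1 := pow_le_one₀ hq (by linarith)
  have h0 : 0 ≤ 1 - (1 - p) ^ t := by linarith
  have h1 : (t : ℝ) ≤ d := by exact_mod_cast htd
  have h3 : (0 : ℝ) ≤ d - t := by linarith
  rcases Nat.eq_zero_or_pos d with hd | hd
  · simp [selectionVar, hd]
  · have h2 : (1 : ℝ) ≤ d := by exact_mod_cast hd
    have h4 : (0 : ℝ) ≤ d - 1 := by linarith
    unfold selectionVar
    positivity

/-- The second moment of a partial average: `t` elements of `N` are selected uniformly, each of
them transmits with probability `p`, and the transmitted values are averaged. -/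
theorem sum_powersetCard_bernoulliMean_le {p : ℝ} (hp0 : 0 ≤ p) (hp1 : p ≤ 1) (N : Finset ι)
    (x : ι → ℝ) (y : ℝ) {t : ℕ} (ht : 1 ≤ t) (htN : t ≤ N.card) :
    ∑ S ∈ N.powersetCard t, 1 / (N.card.choose t : ℝ) * bernoulliMean p S
        (fun R => if R.card = 0 then y else ((∑ j ∈ R, x j) / (R.card : ℝ)) ^ 2)
      ≤ (1 - p) ^ t * y + (1 - (1 - p) ^ t) * ((∑ j ∈ N, x j) / (N.card : ℝ)) ^ 2
        + (samplingVar p t / (N.card : ℝ) + selectionVar p t N.card) * ∑ j ∈ N, x j ^ 2 := by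
  set d := N.card with hd
  have hC : (0 : ℝ) < d.choose t := by exact_mod_cast Nat.choose_pos htN
  have hd0 : (0 : ℝ) < d := by exact_mod_cast ht.trans htN
  have ht0 : (0 : ℝ) < t := by exact_mod_cast ht
  have hq : 0 ≤ 1 - p := by linarith
  have hq1 : (1 - p) ^ t ≤ 1 := pow_le_one₀ hq (by linarith)
  rw [← Finset.mul_sum]
  have h1 : ∀ S ∈ N.powersetCard t, bernoulliMean p S
        (fun R => if R.card = 0 then y else ((∑ j ∈ R, x j) / (R.card : ℝ)) ^ 2)
      ≤ (1 - p) ^ t * y + samplingVar p t * ((∑ j ∈ S, x j ^ 2) / (t : ℝ))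
        + (1 - (1 - p) ^ t) * ((∑ j ∈ S, x j) / (t : ℝ)) ^ 2 := by
    intro S hS
    have := bernoulliMean_mean_sq_le hp0 hp1 S x y
    rwa [(Finset.mem_powersetCard.1 hS).2] at this
  have h2 := Finset.sum_le_sum h1
  rw [Finset.sum_add_distrib, Finset.sum_add_distrib, ← Finset.mul_sum, ← Finset.mul_sum,
    ← Finset.mul_sum, ← Finset.sum_div, Finset.sum_const, Finset.card_powersetCard, ← hd, nsmul_eq_mul] at h2
  have h3 : (∑ S ∈ N.powersetCard t, ∑ j ∈ S, x j ^ 2) / (t : ℝ)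
      = (d.choose t : ℝ) * ((∑ j ∈ N, x j ^ 2) / d) := by
    have := card_mul_sum_powersetCard_sum N (fun j => x j ^ 2) t
    rw [← hd] at this
    field_simp
    linarith
  -- The fixed-size bound again, now for choosing `S` inside `N`: its variance part becomes
  -- `selectionVar`. The `samplingVar` part is linear in the squares and averages exactly.
  have h4 := sum_powersetCard_mean_sq_le N x ht htN
  rw [← hd] at h4
  rw [h3] at h2
  have h5 := h2.trans (add_le_add_right (mul_le_mul_of_nonneg_left h4
    (sub_nonneg.2 hq1)) _)
  rw [one_div, inv_mul_le_iff₀ hC]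
  refine h5.trans (le_of_eq ?_)
  have h6 : selectionVar p t d
      = (1 - (1 - p) ^ t) * (((d : ℝ) - t) / (t * ((d : ℝ) - 1)) / d) := by
    rw [selectionVar, div_div, mul_div_assoc]
    congr 2
    ring
  rw [h6]
  ring

end Subsets

/-- A sequence with summable expected norms is almost surely summable. -/
theorem ae_summable_norm {Ω : Type*} [MeasurableSpace Ω] {μ : Measure Ω} {E : Type*} [NormedAddCommGroup E] {Y : ℕ → Ω → E}
    (hY : ∀ k, Integrable (Y k) μ) (hs : Summable fun k => ∫ ω, ‖Y k ω‖ ∂μ) :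
    ∀ᵐ ω ∂μ, Summable fun k => ‖Y k ω‖ := by
  have h1 : ∫⁻ ω, ∑' k, ‖Y k ω‖ₑ ∂μ ≠ ⊤ := by
    rw [lintegral_tsum fun k => (hY k).aestronglyMeasurable.enorm]
    have h2 : ∀ k, ∫⁻ ω, ‖Y k ω‖ₑ ∂μ = ENNReal.ofReal (∫ ω, ‖Y k ω‖ ∂μ) := fun k =>
      (ofReal_integral_norm_eq_lintegral_enorm (hY k)).symm
    simp_rw [h2]
    exact hs.tsum_ofReal_ne_top
  have h3 := ae_lt_top' (AEMeasurable.tsum fun k =>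
    (hY k).aestronglyMeasurable.enorm) h1
  filter_upwards [h3] with ω hω
  have h4 : Summable fun k => ‖Y k ω‖₊ := by
    rw [← ENNReal.tsum_coe_ne_top_iff_summable]
    exact hω.ne
  exact NNReal.summable_coe.2 h4

/-! ### Laws of the random selections. -/

section Probability

variable {Ω : Type*} [MeasurableSpace Ω] {μ : Measure Ω} [IsProbabilityMeasure μ]

/-- Expectation of a function of two independent random variables with finitely many values. -/
theorem integral_indep_eq_integral_integral {ζ β : Type*} [Finite ζ] [Finite β]
    [MeasurableSpace ζ] [MeasurableSpace β] [MeasurableSingletonClass ζ]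
    [MeasurableSingletonClass β] {Z : Ω → ζ} {U : Ω → β} (hZ : Measurable Z) (hU : Measurable U)
    (h : IndepFun Z U μ) (F : ζ → β → ℝ) :
    ∫ ω, F (Z ω) (U ω) ∂μ = ∫ ω, ∫ ω', F (Z ω') (U ω) ∂μ ∂μ := by
  have hmap := (indepFun_iff_map_prod_eq_prod_map_map hZ.aemeasurable hU.aemeasurable).1 h
  have : IsProbabilityMeasure (μ.map Z) := Measure.isProbabilityMeasure_map hZ.aemeasurable
  have : IsProbabilityMeasure (μ.map U) := Measure.isProbabilityMeasure_map hU.aemeasurable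
  have h1 : ∫ ω, F (Z ω) (U ω) ∂μ
      = ∫ q, F q.1 q.2 ∂(μ.map fun ω => (Z ω, U ω)) := by
    rw [integral_map (hZ.prodMk hU).aemeasurable
      (measurable_of_countable _).aestronglyMeasurable]
  rw [h1, hmap, integral_prod_symm _ .of_finite,
    integral_map hU.aemeasurable (measurable_of_countable _).aestronglyMeasurable]
  refine integral_congr_ae (.of_forall fun ω => ?_)
  exact integral_map hZ.aemeasurable (measurable_of_countable _).aestronglyMeasurable

/-- Finitely many values make every function of `Z` measurable and bounded, so no regularity of `F`
is needed. -/
theorem memLp_comp_of_finite {ζ E : Type*} [Finite ζ] [MeasurableSpace ζ]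
    [MeasurableSingletonClass ζ] [NormedAddCommGroup E] {Z : Ω → ζ} (hZ : Measurable Z)
    (F : ζ → E) (q : ENNReal) : MemLp (fun ω => F (Z ω)) q μ := by
  have : IsProbabilityMeasure (μ.map Z) := Measure.isProbabilityMeasure_map hZ.aemeasurable
  have h : MemLp F q (μ.map Z) := .of_discrete
  exact (memLp_map_measure_iff h.1 hZ.aemeasurable).1 h

variable {m n : ℕ}

/-- A given coordinate belongs to a uniform `s`-element set of coordinates with probability
`s / n`. -/
theorem IsUniformSubset.measureReal_mem {s : ℕ} {T : Ω → Finset (Fin n)} (hT : Measurable T)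
    (h : IsUniformSubset μ T Finset.univ s) (hs : s ≤ n) (l : Fin n) :
    μ.real {ω | l ∈ T ω} = (s : ℝ) / n := by
  have hset : {ω | l ∈ T ω}
      = ⋃ R ∈ (Finset.univ.powersetCard s).filter (l ∈ ·), {ω | T ω = R} := by
    ext ω
    simp only [Set.mem_ofPred_eq, Finset.mem_filter, Set.mem_iUnion, exists_prop,
      exists_eq_right']
    exact ⟨fun hl => ⟨h.mem ω, hl⟩, fun hl => hl.2⟩
  rw [hset, measureReal_biUnion_finset]
  · rw [Finset.sum_congr rfl fun R hR => h.uniform R (Finset.mem_filter.1 hR).1]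
    -- Applied to the indicator of `l`, the first-moment identity counts the `s`-element sets that
    -- contain `l`.
    have h1 := card_mul_sum_powersetCard_sum Finset.univ (fun j : Fin n => if j = l then (1 : ℝ)
      else 0) s
    simp only [Finset.sum_ite_eq', Finset.mem_univ, if_true, Finset.card_univ, Fintype.card_fin,
      mul_one] at h1
    rw [← Finset.sum_filter] at h1
    simp only [Finset.card_univ, Fintype.card_fin]
    rw [← Finset.sum_div]
    have hn : (n : ℝ) ≠ 0 := by have := l.pos; positivity
    have hC : ((n.choose s : ℕ) : ℝ) ≠ 0 := by
      exact_mod_cast (Nat.choose_pos hs).ne'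
    field_simp
    linarith
  · intro R _ R' _ hne
    rw [Function.onFun, Set.disjoint_left]
    intro ω h1 h2
    exact hne (h1.symm.trans h2)
  · intro R _
    exact hT (measurableSet_singleton R)

/-- The law of the set of nodes of `S₀` that transmit a given coordinate. -/
theorem measureReal_filter_eq {s : ℕ} {T : Fin m → Ω → Finset (Fin n)}
    (hT : ∀ j, Measurable (T j)) (hunif : ∀ j, IsUniformSubset μ (T j) Finset.univ s)
    (hind : iIndepFun T μ) (hs : s ≤ n) (l : Fin n) {S R : Finset (Fin m)} (hR : R ⊆ S) :
    μ.real {ω | S.filter (fun j => l ∈ T j ω) = R}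
      = ((s : ℝ) / n) ^ R.card * (1 - (s : ℝ) / n) ^ (S.card - R.card) := by
  have hset : {ω | S.filter (fun j => l ∈ T j ω) = R}
      = ⋂ j ∈ S, T j ⁻¹' {Q | l ∈ Q ↔ j ∈ R} := by
    ext ω
    simp only [Set.mem_ofPred_eq, Set.mem_iInter, Set.mem_preimage, Finset.ext_iff,
      Finset.mem_filter]
    constructor
    · intro h j hj
      rw [← h j]; simp [hj]
    · intro h j
      by_cases hj : j ∈ S
      · rw [← h j hj]; simp [hj]
      · simp only [hj, false_and, false_iff]
        exact fun h' => hj (hR h')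
  rw [measureReal_def, hset, hind.measure_inter_preimage_eq_mul S
    (fun j _ => Set.Finite.measurableSet (Set.toFinite _)), ENNReal.toReal_prod]
  have h1 : ∀ j ∈ S, (μ (T j ⁻¹' {Q | l ∈ Q ↔ j ∈ R})).toReal
      = if j ∈ R then (s : ℝ) / n else 1 - (s : ℝ) / n := by
    intro j _
    have hm := (hunif j).measureReal_mem (hT j) hs l
    split_ifs with hj
    · rw [← hm, measureReal_def]
      simp only [hj, iff_true]
      rfl
    · rw [← hm]
      have hmeas : MeasurableSet {ω | l ∈ T j ω} :=
        hT j (Set.Finite.measurableSet (Set.toFinite {Q | l ∈ Q}))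
      rw [← probReal_compl_eq_one_sub hmeas, measureReal_def]
      simp only [hj, iff_false]
      rfl
  rw [Finset.prod_congr rfl h1, Finset.prod_ite, Finset.prod_const, Finset.prod_const,
    Finset.filter_mem_eq_inter, Finset.inter_eq_right.2 hR, Finset.filter_notMem_eq_sdiff,
    Finset.card_sdiff_of_subset hR]

/-- Expectation of a function of the random set of the selected nodes that transmit a given
coordinate. -/
theorem integral_transmitters {s t : ℕ} {N : Finset (Fin m)} {X : Ω → Finset (Fin m)}
    {T : Fin m → Ω → Finset (Fin n)} (hX : Measurable X) (hT : ∀ j, Measurable (T j))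
    (hXu : IsUniformSubset μ X N t) (hTu : ∀ j, IsUniformSubset μ (T j) Finset.univ s)
    (hind : iIndepFun T μ) (hXT : IndepFun X (fun ω j => T j ω) μ) (hs : s ≤ n) (l : Fin n)
    (g : Finset (Fin m) → ℝ) :
    ∫ ω, g ((X ω).filter fun j => l ∈ T j ω) ∂μ
      = ∑ S ∈ N.powersetCard t, 1 / (N.card.choose t : ℝ) * bernoulliMean ((s : ℝ) / n) S g := by
  have hTm : Measurable fun ω j => T j ω := measurable_pi_lambda _ hT
  have hmA : ∀ S, MeasurableSet {ω | X ω = S} := fun S => hX (measurableSet_singleton S)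
  have hmB : ∀ S R : Finset (Fin m),
      MeasurableSet {ω | S.filter (fun j => l ∈ T j ω) = R} := fun S R =>
    hTm (Set.Finite.measurableSet
      (Set.toFinite {Q : Fin m → Finset (Fin n) | S.filter (fun j => l ∈ Q j) = R}))
  have hpt : ∀ ω, g ((X ω).filter fun j => l ∈ T j ω)
      = ∑ S ∈ N.powersetCard t, ∑ R ∈ S.powerset,
        ({ω | X ω = S} ∩ {ω | S.filter (fun j => l ∈ T j ω) = R}).indicator
          (fun _ => g R) ω := by
    intro ω
    rw [Finset.sum_eq_single_of_mem (X ω) (hXu.mem ω)]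
    · rw [Finset.sum_eq_single_of_mem _ (Finset.mem_powerset.2
        (Finset.filter_subset (fun j => l ∈ T j ω) (X ω)))]
      · simp
      · intro R _ hne
        exact Set.indicator_of_notMem (fun h => hne h.2.symm) _
    · intro S _ hne
      refine Finset.sum_eq_zero fun R _ => Set.indicator_of_notMem (fun h => hne h.1.symm) _
  have hint : ∀ S R, Integrable (({ω | X ω = S} ∩ {ω | S.filter (fun j => l ∈ T j ω) = R}).indicator
          (fun _ => g R)) μ := fun S R =>
    (integrable_const _).indicator ((hmA S).inter (hmB S R))
  simp_rw [hpt]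
  rw [integral_finsetSum _ fun S _ => integrable_finsetSum _ fun R _ => hint S R]
  refine Finset.sum_congr rfl fun S hS => ?_
  rw [integral_finsetSum _ fun R _ => hint S R, bernoulliMean, Finset.mul_sum]
  refine Finset.sum_congr rfl fun R hR => ?_
  rw [integral_indicator ((hmA S).inter (hmB S R)), setIntegral_const, smul_eq_mul]
  have h1 := hXT.measure_inter_preimage_eq_mul {S}
    {Q : Fin m → Finset (Fin n) | S.filter (fun j => l ∈ Q j) = R}
    (measurableSet_singleton S) (Set.Finite.measurableSet (Set.toFinite _))
  have h2 : μ.real ({ω | X ω = S} ∩ {ω | S.filter (fun j => l ∈ T j ω) = R})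
      = μ.real {ω | X ω = S} * μ.real {ω | S.filter (fun j => l ∈ T j ω) = R} := by
    simp only [measureReal_def]
    rw [← ENNReal.toReal_mul]
    exact congrArg ENNReal.toReal h1
  rw [h2, hXu.uniform S hS, measureReal_filter_eq hT hTu hind hs l (Finset.mem_powerset.1 hR)]
  ring

end Probability

/-! ### Pathwise estimates for the aggregation. -/

section Deterministic

variable {m n : ℕ}

theorem supNorm_le_iff {w : Vec n} {r : ℝ} (hr : 0 ≤ r) : supNorm w ≤ r ↔ ∀ l, |w l| ≤ r :=
  pi_norm_le_iff_of_nonneg hr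

/-- The mean of a family of vectors. -/
def mean (W : Fin m → Vec n) : Vec n := (1 / (m : ℝ)) • ∑ i, W i

/-- The consensus error of a family of vectors. -/
def spread (W : Fin m → Vec n) : ℝ := ∑ i, ‖W i - mean W‖ ^ 2

theorem spread_nonneg (W : Fin m → Vec n) : 0 ≤ spread W :=
  Finset.sum_nonneg fun _ _ => sq_nonneg _

theorem sum_sub_mean [NeZero m] (W : Fin m → Vec n) : ∑ i, (W i - mean W) = 0 := by
  have hm : (m : ℝ) ≠ 0 := NeZero.ne _
  rw [Finset.sum_sub_distrib, Finset.sum_const, Finset.card_univ, Fintype.card_fin, mean,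
    ← Nat.cast_smul_eq_nsmul ℝ, smul_smul, mul_one_div_cancel hm, one_smul, sub_self]

/-- The parallel axis identity: the cross terms vanish because deviations from the mean sum to zero.
-/
theorem sum_norm_sub_sq [NeZero m] (W : Fin m → Vec n) (a : Vec n) :
    ∑ i, ‖W i - a‖ ^ 2 = spread W + m * ‖mean W - a‖ ^ 2 := by
  have h : ∀ i, ‖W i - a‖ ^ 2
      = ‖W i - mean W‖ ^ 2 + 2 * inner ℝ (W i - mean W) (mean W - a) + ‖mean W - a‖ ^ 2 :=
    fun i => by rw [← norm_add_sq_real, sub_add_sub_cancel]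
  simp_rw [h]
  rw [Finset.sum_add_distrib, Finset.sum_add_distrib, ← Finset.mul_sum, ← sum_inner,
    sum_sub_mean]
  simp [spread]

theorem spread_le [NeZero m] (W : Fin m → Vec n) (a : Vec n) :
    spread W ≤ ∑ i, ‖W i - a‖ ^ 2 := by
  rw [sum_norm_sub_sq]
  have : 0 ≤ (m : ℝ) * ‖mean W - a‖ ^ 2 := by positivity
  linarith

theorem norm_sub_mean_sq_le (W : Fin m → Vec n) (i : Fin m) : ‖W i - mean W‖ ^ 2 ≤ spread W :=
  Finset.single_le_sum (f := fun i => ‖W i - mean W‖ ^ 2) (fun _ _ => sq_nonneg _)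
    (Finset.mem_univ i)

theorem pme_apply (W : Fin m → Vec n) (i : Fin m) (S : Finset (Fin m))
    (T : Fin m → Finset (Fin n)) (l : Fin n) :
    pme W i S T l = if (S.filter fun j => l ∈ T j).card = 0 then W i l
      else (∑ j ∈ S.filter (fun j => l ∈ T j), W j l)
        / ((S.filter fun j => l ∈ T j).card : ℝ) := by
  simp only [pme, sparse, Finset.sum_filter]

/-- The weights of a partial average sum to one, so it commutes with translations. This permits
centring at the mean. -/
theorem pme_apply_sub (W : Fin m → Vec n) (i : Fin m) (S : Finset (Fin m))
    (T : Fin m → Finset (Fin n)) (l : Fin n) (a : ℝ) :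
    pme W i S T l - a = if (S.filter fun j => l ∈ T j).card = 0 then W i l - a
      else (∑ j ∈ S.filter (fun j => l ∈ T j), (W j l - a))
        / ((S.filter fun j => l ∈ T j).card : ℝ) := by
  rw [pme_apply]
  split_ifs with h
  · rfl
  · have h' : ((S.filter fun j => l ∈ T j).card : ℝ) ≠ 0 := by exact_mod_cast h
    rw [Finset.sum_sub_distrib, Finset.sum_const, nsmul_eq_mul]
    field_simp

theorem abs_pme_apply_sub_le {W : Fin m → Vec n} {l : Fin n} {a r : ℝ}
    (h : ∀ j, |W j l - a| ≤ r) (i : Fin m) (S : Finset (Fin m)) (T : Fin m → Finset (Fin n)) :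
    |pme W i S T l - a| ≤ r := by
  rw [pme_apply_sub]
  split_ifs with h0
  · exact h i
  · have h' : (0 : ℝ) < ((S.filter fun j => l ∈ T j).card : ℝ) := by
      exact_mod_cast Nat.pos_of_ne_zero h0
    rw [abs_div, abs_of_pos h', div_le_iff₀ h', mul_comm, ← nsmul_eq_mul]
    exact (Finset.abs_sum_le_sum_abs _ _).trans (Finset.sum_le_card_nsmul _ _ _ fun j _ => h j)

variable {D : Fin m → Type*} {Ω : Type*}

theorem PaME.abs_aggregate_apply_sub_le (A : PaME m n D Ω) (k : ℕ) {W : Fin m → Vec n} {l : Fin n}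
    {a r : ℝ} (h : ∀ j, |W j l - a| ≤ r) (i : Fin m) (ω : Ω) :
    |A.aggregate k W i ω l - a| ≤ r := by
  unfold aggregate
  split_ifs
  · exact abs_pme_apply_sub_le h _ _ _
  · exact h i

theorem PaME.supNorm_aggregate_le (A : PaME m n D Ω) (k : ℕ) {W : Fin m → Vec n} {r : ℝ}
    (hr : 0 ≤ r) (h : ∀ j, supNorm (W j) ≤ r) (i : Fin m) (ω : Ω) :
    supNorm (A.aggregate k W i ω) ≤ r := by
  rw [supNorm_le_iff hr]
  intro l
  have := A.abs_aggregate_apply_sub_le k (W := W) (l := l) (a := 0) (r := r)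
    (fun j => by simpa using (supNorm_le_iff hr).1 (h j) l) i ω
  simpa using this

/-- The worst node may differ from coordinate to coordinate, hence the sum over all nodes on the
right. -/
theorem PaME.norm_aggregate_sub_sq_le (A : PaME m n D Ω) (k : ℕ) (W : Fin m → Vec n)
    (a : Vec n) (i : Fin m) (ω : Ω) :
    ‖A.aggregate k W i ω - a‖ ^ 2 ≤ ∑ j, ‖W j - a‖ ^ 2 := by
  simp_rw [EuclideanSpace.real_norm_sq_eq]
  rw [Finset.sum_comm]
  refine Finset.sum_le_sum fun l _ => ?_
  have h := A.abs_aggregate_apply_sub_le k (W := W) (l := l) (a := a l)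
    (r := √(∑ j, (W j l - a l) ^ 2)) (fun j => Real.abs_le_sqrt
      (Finset.single_le_sum (f := fun j => (W j l - a l) ^ 2) (fun _ _ => sq_nonneg _)
        (Finset.mem_univ j))) i ω
  have h2 : 0 ≤ ∑ j, (W j l - a l) ^ 2 := Finset.sum_nonneg fun _ _ => sq_nonneg _
  have h3 := pow_le_pow_left₀ (abs_nonneg _) h 2
  rw [sq_abs, Real.sq_sqrt h2] at h3
  simpa using h3

/-- The aggregation moves the parameters by at most the consensus error. -/
theorem PaME.norm_aggregate_sub_self_sq_le (A : PaME m n D Ω) (k : ℕ) (W : Fin m → Vec n)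
    (i : Fin m) (ω : Ω) : ‖A.aggregate k W i ω - W i‖ ^ 2 ≤ 4 * spread W := by
  have h1 := A.norm_aggregate_sub_sq_le k W (mean W) i ω
  have h2 := norm_sub_mean_sq_le W i
  have h3 := norm_sub_le (A.aggregate k W i ω - mean W) (W i - mean W)
  rw [sub_sub_sub_cancel_right] at h3
  have h4 := pow_le_pow_left₀ (norm_nonneg _) h3 2
  change _ ≤ spread W at h1
  nlinarith [sq_nonneg (‖A.aggregate k W i ω - mean W‖ - ‖W i - mean W‖)]

end Deterministic

/-! ### Contraction of the consensus error for frozen parameters. -/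

section Setup

variable {m n : ℕ} {D : Fin m → Type*} [∀ i, Fintype (D i)] {Ω : Type*} [MeasurableSpace Ω]
  {μ : Measure Ω} {A : PaME m n D Ω} {α ν : Fin m → ℝ} {k₀ s : ℕ} {σ₀ γ δ : ℝ}

theorem Setup.p_nonneg (_ : Setup A μ α ν k₀ s σ₀ γ δ) : 0 ≤ (s : ℝ) / n := by positivity

theorem Setup.p_le_one (h : Setup A μ α ν k₀ s σ₀ γ δ) : (s : ℝ) / n ≤ 1 :=
  div_le_one_of_le₀ (by exact_mod_cast h.s_lt.le) (by positivity)

theorem Setup.participants_le (h : Setup A μ α ν k₀ s σ₀ γ δ) (i : Fin m) :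
    A.participants ν i ≤ (A.nbhd i).card := by
  refine Nat.floor_le_of_le ?_
  exact mul_le_of_le_one_left (by positivity) (h.ν_mem i).2

theorem Setup.weight_nonneg (h : Setup A μ α ν k₀ s σ₀ γ δ) (j : Fin m) :
    0 ≤ samplingVar ((s : ℝ) / n) (A.participants ν j) / ((A.nbhd j).card : ℝ)
      + selectionVar ((s : ℝ) / n) (A.participants ν j) (A.nbhd j).card :=
  add_nonneg (div_nonneg (samplingVar_nonneg h.p_nonneg h.p_le_one _) (by positivity))
    (selectionVar_nonneg h.p_nonneg h.p_le_one (h.participants_le j))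

/-- With no participant the left side of `contraction` is at least `(1 + ζ) ^ 2 ≥ 1`, while the
right side is at most `1`. -/
theorem Setup.one_le_participants (h : Setup A μ α ν k₀ s σ₀ γ δ) (i : Fin m) :
    1 ≤ A.participants ν i := by
  by_contra h0
  have h1 : A.participants ν i = 0 := by omega
  have h2 := h.contraction i
  rw [h1, pow_zero, one_mul] at h2
  have h3 := Finset.sum_nonneg fun j (_ : j ∈ A.nbhd i) => h.weight_nonneg j
  have h4 : γ ^ (-(k₀ : ℝ) / 2) ≤ 1 :=
    Real.rpow_le_one_of_one_le_of_nonpos h.one_lt_γ.le (by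
      have : (0 : ℝ) ≤ k₀ := by positivity
      linarith)
  have h5 := zeta_nonneg (commMatrix A.nbhd)
  have h6 := h.zeta_lt
  nlinarith

theorem Setup.γ_pos (h : Setup A μ α ν k₀ s σ₀ γ δ) : 0 < γ := by linarith [h.one_lt_γ]

/-- The contraction factor of a communication beats the growth of the penalties. -/
theorem Setup.exists_contraction_factor [NeZero m] (h : Setup A μ α ν k₀ s σ₀ γ δ) :
    ∃ ρ : ℝ, 0 ≤ ρ ∧ ρ < (γ ^ k₀)⁻¹ ∧ ∀ i,
      zeta (commMatrix A.nbhd) ^ 2 + ((1 - (s : ℝ) / n) ^ A.participants ν i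
        + ∑ j ∈ A.nbhd i, (samplingVar ((s : ℝ) / n) (A.participants ν j) / ((A.nbhd j).card : ℝ)
          + selectionVar ((s : ℝ) / n) (A.participants ν j) (A.nbhd j).card)) ≤ ρ := by
  set z := zeta (commMatrix A.nbhd)
  have hz : 0 ≤ z := zeta_nonneg _
  set F : Fin m → ℝ := fun i => z ^ 2 + ((1 - (s : ℝ) / n) ^ A.participants ν i
        + ∑ j ∈ A.nbhd i, (samplingVar ((s : ℝ) / n) (A.participants ν j) / ((A.nbhd j).card : ℝ)
          + selectionVar ((s : ℝ) / n) (A.participants ν j) (A.nbhd j).card)) with hF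
  have hq : ∀ i, 0 ≤ (1 - (s : ℝ) / n) ^ A.participants ν i := fun i =>
    pow_nonneg (sub_nonneg.2 h.p_le_one) _
  obtain ⟨i₀, hi₀⟩ := Finite.exists_max F
  refine ⟨F i₀, ?_, ?_, hi₀⟩
  · have := Finset.sum_nonneg fun j (_ : j ∈ A.nbhd i₀) => h.weight_nonneg j
    have := hq i₀
    simp only [hF]
    positivity
  · have h1 := h.contraction i₀
    have h2 := h.zeta_lt
    have hθ : (γ ^ (-(k₀ : ℝ) / 2)) ^ 2 = (γ ^ k₀)⁻¹ := by
      rw [← Real.rpow_natCast, ← Real.rpow_mul h.γ_pos.le, ← Real.rpow_natCast γ,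
        ← Real.rpow_neg h.γ_pos.le]
      congr 1
      push_cast
      ring
    rw [← hθ]
    set θ := γ ^ (-(k₀ : ℝ) / 2)
    -- The factor `(1 + z) ^ 2` in `contraction` may be lowered to `1`, and `(θ - z) ^ 2 + z ^ 2 ≤ θ
    -- ^ 2` because `0 ≤ z ≤ θ`.
    have h3 := mul_nonneg (hq i₀) (by positivity : (0 : ℝ) ≤ 2 * z + z ^ 2)
    have h4 := mul_nonneg hz (sub_nonneg.2 h2.le)
    simp only [hF]
    nlinarith

/-- A communication contracts the expected consensus error of fixed parameters. -/
theorem Setup.integral_pme_le [NeZero m] [IsProbabilityMeasure μ]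
    (h : Setup A μ α ν k₀ s σ₀ γ δ) (network : IsNetwork A.nbhd) (mixing : IsMixing A.nbhd) {k : ℕ}
    (hk : k₀ ∣ k) {ρ : ℝ}
    (hρ : ∀ i, zeta (commMatrix A.nbhd) ^ 2 + ((1 - (s : ℝ) / n) ^ A.participants ν i
        + ∑ j ∈ A.nbhd i, (samplingVar ((s : ℝ) / n) (A.participants ν j) / ((A.nbhd j).card : ℝ)
          + selectionVar ((s : ℝ) / n) (A.participants ν j) (A.nbhd j).card)) ≤ ρ)
    (W : Fin m → Vec n) :
    ∫ ω, ∑ i, ‖pme W i (A.select k i ω) (fun j => A.coords k i j ω) - mean W‖ ^ 2 ∂μ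
      ≤ ρ * spread W := by
  set z := zeta (commMatrix A.nbhd)
  set p := (s : ℝ) / n
  set e : Fin m → ℝ := fun j => samplingVar p (A.participants ν j) / ((A.nbhd j).card : ℝ)
    + selectionVar p (A.participants ν j) (A.nbhd j).card with he
  set x : Fin n → Fin m → ℝ := fun l j => W j l - mean W l with hx
  set q : Fin m → ℝ := fun i => (1 - p) ^ A.participants ν i with hq
  have hq0 : ∀ i, 0 ≤ q i := fun i => pow_nonneg (sub_nonneg.2 h.p_le_one) _
  have hmeas : ∀ i, Measurable fun ω => (A.select k i ω, fun j => A.coords k i j ω) := fun i =>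
    (h.measurable_select k i).prodMk (measurable_pi_lambda _ fun j => h.measurable_coords k i j)
  have hint : ∀ i l, Integrable (fun ω =>
      (pme W i (A.select k i ω) (fun j => A.coords k i j ω) l - mean W l) ^ 2) μ := fun i l =>
    memLp_one_iff_integrable.1 (memLp_comp_of_finite (hmeas i)
      (fun z => (pme W i z.1 z.2 l - mean W l) ^ 2) 1)
  have hcoord : ∀ l i,
      ∫ ω, (pme W i (A.select k i ω) (fun j => A.coords k i j ω) l - mean W l) ^ 2 ∂μ
        ≤ q i * x l i ^ 2 + ((∑ j ∈ A.nbhd i, x l j) / ((A.nbhd i).card : ℝ)) ^ 2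
          + e i * ∑ j ∈ A.nbhd i, x l j ^ 2 := by
    intro l i
    have h1 := integral_transmitters (h.measurable_select k i) (h.measurable_coords k i)
      (h.select_uniform k hk i) (h.coords_uniform k hk i) (h.coords_indep k hk i)
      (h.select_indep k hk i) h.s_lt.le l
      (fun R => if R.card = 0 then x l i ^ 2 else ((∑ j ∈ R, x l j) / (R.card : ℝ)) ^ 2)
    have h2 := sum_powersetCard_bernoulliMean_le h.p_nonneg h.p_le_one (A.nbhd i) (x l)
      (x l i ^ 2) (h.one_le_participants i) (h.participants_le i)
    have h3 : ∀ ω, (pme W i (A.select k i ω) (fun j => A.coords k i j ω) l - mean W l) ^ 2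
        = if ((A.select k i ω).filter fun j => l ∈ A.coords k i j ω).card = 0 then x l i ^ 2
          else ((∑ j ∈ (A.select k i ω).filter (fun j => l ∈ A.coords k i j ω), x l j)
            / (((A.select k i ω).filter fun j => l ∈ A.coords k i j ω).card : ℝ)) ^ 2 := by
      intro ω
      rw [pme_apply_sub]
      split_ifs <;> rfl
    simp_rw [h3]
    rw [h1]
    refine h2.trans ?_
    -- The factor depends on the node; bounding it by `1` leaves the unweighted sum to which the
    -- spectral gap applies.
    have h4 : (1 - q i) * ((∑ j ∈ A.nbhd i, x l j) / ((A.nbhd i).card : ℝ)) ^ 2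
        ≤ ((∑ j ∈ A.nbhd i, x l j) / ((A.nbhd i).card : ℝ)) ^ 2 :=
      mul_le_of_le_one_left (sq_nonneg _) (by linarith [hq0 i])
    simp only [hq, he] at h4 ⊢
    linarith
  have hsum0 : ∀ l, ∑ j, x l j = 0 := by
    intro l
    have := congrArg (fun v : Vec n => v l) (sum_sub_mean W)
    simpa [hx] using this
  have hrow : ∀ l, ∑ i, ∫ ω,
      (pme W i (A.select k i ω) (fun j => A.coords k i j ω) l - mean W l) ^ 2 ∂μ
        ≤ ρ * ∑ i, x l i ^ 2 := by
    intro l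
    refine (Finset.sum_le_sum fun i _ => hcoord l i).trans ?_
    have h1 := sum_nbhd_mean_sq_le network mixing (x l) (hsum0 l)
    -- By symmetry of the graph, the variance that receivers collect is charged to the senders;
    -- hence the sum over neighbours in `contraction`.
    have h2 : ∑ i, e i * ∑ j ∈ A.nbhd i, x l j ^ 2
        = ∑ i, (∑ j ∈ A.nbhd i, e j) * x l i ^ 2 := by
      simp_rw [Finset.mul_sum, Finset.sum_mul]
      exact network.sum_swap fun i j => e i * x l j ^ 2
    rw [Finset.sum_add_distrib, Finset.sum_add_distrib, h2]
    have h3 : ∑ i, (z ^ 2 + (q i + ∑ j ∈ A.nbhd i, e j)) * x l i ^ 2 ≤ ∑ i, ρ * x l i ^ 2 :=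
      Finset.sum_le_sum fun i _ => mul_le_mul_of_nonneg_right (hρ i) (sq_nonneg _)
    rw [← Finset.mul_sum] at h3
    refine le_trans ?_ h3
    simp_rw [add_mul]
    rw [Finset.sum_add_distrib, Finset.sum_add_distrib, ← Finset.mul_sum]
    linarith
  have hleft : ∫ ω, ∑ i, ‖pme W i (A.select k i ω) (fun j => A.coords k i j ω) - mean W‖ ^ 2 ∂μ
      = ∑ l, ∑ i, ∫ ω,
        (pme W i (A.select k i ω) (fun j => A.coords k i j ω) l - mean W l) ^ 2 ∂μ := by
    simp_rw [EuclideanSpace.real_norm_sq_eq, PiLp.sub_apply]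
    rw [integral_finsetSum _ fun i _ => integrable_finsetSum _ fun l _ => hint i l,
      Finset.sum_comm]
    exact Finset.sum_congr rfl fun i _ => integral_finsetSum _ fun l _ => hint i l
  have hright : spread W = ∑ l, ∑ i, x l i ^ 2 := by
    simp_rw [spread, EuclideanSpace.real_norm_sq_eq, PiLp.sub_apply]
    rw [Finset.sum_comm]
  rw [hleft, hright, Finset.mul_sum]
  exact Finset.sum_le_sum fun l _ => hrow l

end Setup

/-! ### Dependence of the iterates on finitely many random choices. -/

section History

variable {m n : ℕ} {D : Fin m → Type*} {Ω : Type*}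

/-- The values of all random choices of the first `k` iterations. -/
abbrev History (m n : ℕ) (D : Fin m → Type*) (k : ℕ) :=
  Fin k → (Fin m → Finset (Fin m)) × (Fin m → Fin m → Finset (Fin n)) × ((i : Fin m) → Finset (D i))

namespace PaME

/-- All random choices of the first `k` iterations. -/
def history (A : PaME m n D Ω) (k : ℕ) (ω : Ω) : History m n D k :=
  fun l => ((fun i => A.select l i ω), (fun i j => A.coords l i j ω), (fun i => A.batch l i ω))

theorem history_eq_iff (A : PaME m n D Ω) {k : ℕ} {ω ω' : Ω} :
    A.history k ω = A.history k ω' ↔ ∀ l < k, (∀ i, A.select l i ω = A.select l i ω') ∧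
      (∀ i j, A.coords l i j ω = A.coords l i j ω') ∧ ∀ i, A.batch l i ω = A.batch l i ω' := by
  simp only [history, funext_iff, Prod.mk.injEq, Fin.forall_iff]

theorem v_eq_of_history (A : PaME m n D Ω) {k : ℕ} {ω ω' : Ω}
    (hw : ∀ i, A.w k i ω = A.w k i ω') (h : A.history (k + 1) ω = A.history (k + 1) ω')
    (i : Fin m) : A.v k i ω = A.v k i ω' := by
  rw [history_eq_iff] at h
  obtain ⟨h1, h2, _⟩ := h k k.lt_succ_self
  simp only [v, aggregate, hw, h1, h2]

theorem history_eq_of_le (A : PaME m n D Ω) {k l : ℕ} (hkl : k ≤ l) {ω ω' : Ω}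
    (h : A.history l ω = A.history l ω') : A.history k ω = A.history k ω' := by
  rw [history_eq_iff] at h ⊢
  exact fun a ha => h a (ha.trans_le hkl)

/-- Two uses: iterates take finitely many values, hence have all moments, and `w k` is independent
of the selections of a communication at `k`. -/
theorem w_factorsThrough (A : PaME m n D Ω) (k : ℕ) :
    (fun ω i => A.w k i ω).FactorsThrough (A.history k) := by
  induction k with
  | zero => intro ω ω' _; rfl
  | succ k ih =>
    intro ω ω' h
    have hw : ∀ i, A.w k i ω = A.w k i ω' :=
      fun i => congrFun (ih (A.history_eq_of_le k.le_succ h)) i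
    have hv := A.v_eq_of_history hw h
    rw [history_eq_iff] at h
    funext i
    -- The latest communication time is at most `k`, so its selection belongs to the history of
    -- length `k + 1`.
    have hc : A.count k i ω = A.count k i ω' := by
      simp only [count]
      rw [(h _ ((Nat.mul_div_le k (A.period i)).trans_lt k.lt_succ_self)).1 i]
    have e : ∀ ω, A.w (k + 1) i ω = A.v k i ω - (1 / (A.penalty k i * (A.count k i ω : ℝ))) •
        gradient (A.loss i (A.batch k i ω)) (A.v k i ω) := fun _ => rfl
    simp only [e, hv, hc, (h k k.lt_succ_self).2.2]

theorem v_factorsThrough (A : PaME m n D Ω) (k : ℕ) :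
    (fun ω i => A.v k i ω).FactorsThrough (A.history (k + 1)) := by
  intro ω ω' h
  have hw := A.w_factorsThrough k (A.history_eq_of_le k.le_succ h)
  exact funext fun i => A.v_eq_of_history (fun i => congrFun hw i) h i

end PaME

end History

/-! ### Gradient bounds on boxes. -/

section Gradients

variable {m n : ℕ} {D : Fin m → Type*} [∀ i, Fintype (D i)] {Ω : Type*} {A : PaME m n D Ω}

theorem isCompact_box (n : ℕ) (r : ℝ) : IsCompact (box n r) := by
  have h : box n r = (EuclideanSpace.equiv (Fin n) ℝ).toHomeomorph ⁻¹' Metric.closedBall 0 r := by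
    ext w
    simp [box, supNorm, EuclideanSpace.equiv]
    exact Iff.rfl
  rw [h, Homeomorph.isCompact_preimage]
  exact isCompact_closedBall _ _

theorem supNorm_le_norm (w : Vec n) : supNorm w ≤ ‖w‖ :=
  (supNorm_le_iff (norm_nonneg _)).2 fun l => PiLp.norm_apply_le w l

theorem supNorm_sub_le (x y : Vec n) : supNorm (x - y) ≤ supNorm x + supNorm y :=
  norm_sub_le (WithLp.ofLp x) (WithLp.ofLp y)

theorem supNorm_smul (c : ℝ) (x : Vec n) : supNorm (c • x) = ‖c‖ * supNorm x :=
  norm_smul c (WithLp.ofLp x)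

theorem exists_norm_gradient_le {f : Vec n → ℝ} (hf : ContDiff ℝ 1 f) (r : ℝ) :
    ∃ G, ∀ x ∈ box n r, ‖gradient f x‖ ≤ G := by
  have hc : Continuous fun x => ‖gradient f x‖ := by
    have : Continuous (gradient f) :=
      (InnerProductSpace.toDual ℝ (Vec n)).symm.continuous.comp (hf.continuous_fderiv one_ne_zero)
    exact this.norm
  obtain ⟨G, hG⟩ := (isCompact_box n r).bddAbove_image hc.continuousOn
  exact ⟨G, fun x hx => hG ⟨x, hx, rfl⟩⟩

theorem PaME.RegularLosses.exists_gradient_bound (losses : A.RegularLosses) (r : ℝ) :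
    ∃ G, 0 ≤ G ∧ ∀ i b, ∀ x ∈ box n r, ‖gradient (A.loss i b) x‖ ≤ G := by
  choose G hG using fun q : (i : Fin m) × Finset (D i) =>
    exists_norm_gradient_le (losses.contDiff q.1 q.2) r
  obtain ⟨K, hK⟩ := (Set.finite_range G).bddAbove
  refine ⟨max K 0, le_max_right _ _, fun i b x hx => ?_⟩
  exact (hG ⟨i, b⟩ x hx).trans ((hK ⟨_, rfl⟩).trans (le_max_left _ _))

/-- The empty batch has zero gradient, so each batch gradient is itself one of the differences in
`gradGap`. Compactness of the box makes that supremum a genuine one. -/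
theorem PaME.RegularLosses.supNorm_gradient_le (losses : A.RegularLosses) {r : ℝ} (i : Fin m)
    (b : Finset (D i)) {x : Vec n} (hx : x ∈ box n r) :
    supNorm (gradient (A.loss i b) x) ≤ A.gradGap i r := by
  obtain ⟨G, -, hG⟩ := losses.exists_gradient_bound r
  refine le_csSup ⟨G + G, ?_⟩ ⟨b, ∅, x, hx, ?_⟩
  · rintro _ ⟨b, c, x, hx, rfl⟩
    exact (supNorm_le_norm _).trans ((norm_sub_le _ _).trans
      (add_le_add (hG i b x hx) (hG i c x hx)))
  · have h0 : gradient (A.loss i ∅) x = 0 := by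
      rw [losses.empty i]
      have : (0 : Vec n → ℝ) = fun _ => 0 := rfl
      rw [this, gradient_fun_const]
    rw [h0, sub_zero]

theorem PaME.RegularLosses.continuous_localLoss (losses : A.RegularLosses) (i : Fin m) :
    Continuous (A.localLoss i) :=
  (losses.contDiff i Finset.univ).continuous

theorem PaME.RegularLosses.continuous_globalLoss (losses : A.RegularLosses) :
    Continuous A.globalLoss :=
  continuous_finsetSum _ fun i _ => losses.continuous_localLoss i

theorem exists_norm_le_on_box {E : Type*} [NormedAddCommGroup E] {f : Vec n → E}
    (hf : Continuous f) (r : ℝ) : ∃ C, ∀ x ∈ box n r, ‖f x‖ ≤ C :=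
  (isCompact_box n r).exists_bound_of_continuousOn hf.continuousOn

end Gradients

/-! ### Boundedness, moments, and the contraction along the iterates. -/

section Iterates

variable {m n : ℕ} {D : Fin m → Type*} [∀ i, Fintype (D i)] {Ω : Type*} [MeasurableSpace Ω]
  {μ : Measure Ω} {A : PaME m n D Ω} {α ν : Fin m → ℝ} {k₀ s : ℕ} {σ₀ γ δ : ℝ}

theorem Setup.count_eq (h : Setup A μ α ν k₀ s σ₀ γ δ) (k : ℕ) (i : Fin m) (ω : Ω) :
    A.count k i ω = A.participants ν i := by
  rw [PaME.count, h.period]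
  exact (Finset.mem_powersetCard.1 ((h.select_uniform _ (dvd_mul_right _ _) i).mem ω)).2

theorem Setup.w_succ (h : Setup A μ α ν k₀ s σ₀ γ δ) (k : ℕ) (i : Fin m) (ω : Ω) :
    A.w (k + 1) i ω = A.v k i ω - (1 / (γ ^ k * σ₀ * (A.participants ν i : ℝ))) •
      gradient (A.loss i (A.batch k i ω)) (A.v k i ω) := by
  have e : A.w (k + 1) i ω = A.v k i ω - (1 / (A.penalty k i * (A.count k i ω : ℝ))) •
      gradient (A.loss i (A.batch k i ω)) (A.v k i ω) := rfl
  rw [e, h.count_eq, PaME.penalty, h.growth, h.penalty₀]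

theorem Setup.v_eq_w (h : Setup A μ α ν k₀ s σ₀ γ δ) {k : ℕ} (hk : ¬ k₀ ∣ k) (i : Fin m) (ω : Ω) :
    A.v k i ω = A.w k i ω := by
  rw [PaME.v, PaME.aggregate, h.period, if_neg hk]

theorem Setup.v_eq_pme (h : Setup A μ α ν k₀ s σ₀ γ δ) {k : ℕ} (hk : k₀ ∣ k) (i : Fin m) (ω : Ω) :
    A.v k i ω = pme (fun j => A.w k j ω) i (A.select k i ω) (fun j => A.coords k i j ω) := by
  rw [PaME.v, PaME.aggregate, h.period, if_pos hk]

theorem Setup.σ₀_pos [NeZero m] (h : Setup A μ α ν k₀ s σ₀ γ δ)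
    (lipschitz : A.LipschitzGradients α δ) : 0 < σ₀ := by
  have h1 := (le_max_left _ _).trans h.threshold_le
  have h2 := le_ciSup (Set.finite_range α).bddAbove 0
  have h3 := lipschitz.α_pos 0
  linarith

theorem inv_geom_sum_le {γ : ℝ} (hγ : 1 < γ) (k : ℕ) :
    ∑ l ∈ Finset.range k, (γ⁻¹) ^ l ≤ γ / (γ - 1) := by
  have h0 : 0 < γ := by linarith
  have h1 : γ⁻¹ < 1 := inv_lt_one_of_one_lt₀ hγ
  have h2 : 0 ≤ γ⁻¹ := by positivity
  calc _ ≤ ∑' l, (γ⁻¹) ^ l :=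
        (summable_geometric_of_lt_one h2 h1).sum_le_tsum _ fun _ _ => by positivity
    _ = γ / (γ - 1) := by
        rw [tsum_geometric_of_lt_one h2 h1]
        have : γ - 1 ≠ 0 := by linarith
        field_simp

/-- All iterates stay in the box of radius `δ`. -/
theorem Setup.w_mem_box [NeZero m] (h : Setup A μ α ν k₀ s σ₀ γ δ) (losses : A.RegularLosses)
    (lipschitz : A.LipschitzGradients α δ) (k : ℕ) (i : Fin m) (ω : Ω) : A.w k i ω ∈ box n δ := by
  have hσ := h.σ₀_pos lipschitz
  have hγ := h.one_lt_γ
  have hγ0 := h.γ_pos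
  have hδ := lipschitz.δ_pos
  set ε := ⨆ i, A.gradGap i (2 * δ) with hε
  set τ : ℝ := ((⨅ i, A.participants ν i : ℕ) : ℝ) with hτ
  have hτ1 : 1 ≤ τ := by
    rw [hτ]; exact_mod_cast le_ciInf h.one_le_participants
  have hτi : ∀ i, τ ≤ A.participants ν i := fun i => by
    rw [hτ]; exact_mod_cast ciInf_le (OrderBot.bddBelow _) i
  have hgap : ∀ i (b : Finset (D i)) x, x ∈ box n (2 * δ) →
      supNorm (gradient (A.loss i b) x) ≤ ε := fun i b x hx =>
    (losses.supNorm_gradient_le i b hx).trans 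
      (le_ciSup (f := fun i => A.gradGap i (2 * δ)) (Set.finite_range _).bddAbove i)
  have hε0 : 0 ≤ ε :=
    (norm_nonneg _).trans (hgap 0 ∅ 0 (by simp [box, supNorm, hδ.le]))
  -- Step `k` moves a coordinate by at most `e * γ⁻¹ ^ k`; the second entry of the threshold says
  -- that these bounds sum to at most `δ`.
  set e := ε / (σ₀ * τ) with he
  have he0 : 0 ≤ e := by positivity
  have heδ : e * (γ / (γ - 1)) ≤ δ := by
    have h1 := (le_max_right _ _).trans h.threshold_le
    rw [← hε, ← hτ, div_le_iff₀ (by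
      have : 0 < γ - 1 := by linarith
      positivity)] at h1
    have h2 : 0 < γ - 1 := by linarith
    rw [he, div_mul_div_comm, div_le_iff₀ (by positivity)]
    linarith
  have key : ∀ k i, supNorm (A.w k i ω) ≤ e * ∑ l ∈ Finset.range k, (γ⁻¹) ^ l := by
    intro k
    induction k with
    | zero => intro i; simp [PaME.w, supNorm]
    | succ k ih =>
      intro i
      have hr0 : 0 ≤ e * ∑ l ∈ Finset.range k, (γ⁻¹) ^ l := by positivity
      have hrδ : e * ∑ l ∈ Finset.range k, (γ⁻¹) ^ l ≤ δ :=
        (mul_le_mul_of_nonneg_left (inv_geom_sum_le hγ k) he0).trans heδ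
      have hv : supNorm (A.v k i ω) ≤ e * ∑ l ∈ Finset.range k, (γ⁻¹) ^ l :=
        A.supNorm_aggregate_le k hr0 ih i ω
      have hv' : A.v k i ω ∈ box n (2 * δ) := by
        change supNorm _ ≤ _
        linarith
      rw [h.w_succ, Finset.sum_range_succ, mul_add]
      refine (supNorm_sub_le _ _).trans (add_le_add hv ?_)
      rw [supNorm_smul, Real.norm_of_nonneg (by positivity)]
      have hp : (0 : ℝ) < A.participants ν i := by linarith [hτi i]
      calc _ ≤ 1 / (γ ^ k * σ₀ * τ) * ε := by
            refine mul_le_mul ?_ (hgap i _ _ hv') (norm_nonneg _) (by positivity)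
            exact one_div_le_one_div_of_le (by positivity)
              (mul_le_mul_of_nonneg_left (hτi i) (by positivity))
        _ = e * γ⁻¹ ^ k := by
            rw [he, inv_pow]
            field_simp
  exact (key k i).trans ((mul_le_mul_of_nonneg_left (inv_geom_sum_le hγ k) he0).trans heδ)

theorem Setup.v_mem_box [NeZero m] (h : Setup A μ α ν k₀ s σ₀ γ δ) (losses : A.RegularLosses)
    (lipschitz : A.LipschitzGradients α δ) (k : ℕ) (i : Fin m) (ω : Ω) : A.v k i ω ∈ box n δ :=
  A.supNorm_aggregate_le k lipschitz.δ_pos.le (fun j => h.w_mem_box losses lipschitz k j ω) i ω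

/-- The gradient steps decay geometrically. -/
theorem Setup.exists_step_bound [NeZero m] (h : Setup A μ α ν k₀ s σ₀ γ δ)
    (losses : A.RegularLosses) (lipschitz : A.LipschitzGradients α δ) :
    ∃ g, 0 ≤ g ∧ ∀ k i ω, ‖A.w (k + 1) i ω - A.v k i ω‖ ≤ g * (γ⁻¹) ^ k := by
  obtain ⟨G, hG0, hG⟩ := losses.exists_gradient_bound δ
  have hσ := h.σ₀_pos lipschitz
  have hγ0 := h.γ_pos
  refine ⟨G / σ₀, by positivity, fun k i ω => ?_⟩
  rw [h.w_succ, sub_sub_cancel_left, norm_neg, norm_smul, Real.norm_of_nonneg (by positivity)]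
  have ht : (1 : ℝ) ≤ A.participants ν i := by exact_mod_cast h.one_le_participants i
  calc _ ≤ 1 / (γ ^ k * σ₀) * G := by
        refine mul_le_mul ?_ (hG i _ _ (h.v_mem_box losses lipschitz k i ω)) (norm_nonneg _)
          (by positivity)
        exact one_div_le_one_div_of_le (by positivity)
          (le_mul_of_one_le_right (by positivity) ht)
    _ = G / σ₀ * γ⁻¹ ^ k := by
        rw [inv_pow]
        field_simp

theorem Setup.measurable_history (h : Setup A μ α ν k₀ s σ₀ γ δ) (k : ℕ) :
    Measurable (A.history k) :=
  measurable_pi_lambda _ fun l => (measurable_pi_lambda _ fun i => h.measurable_select l i).prodMk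
    ((measurable_pi_lambda _ fun i => measurable_pi_lambda _ fun j =>
      h.measurable_coords l i j).prodMk (measurable_pi_lambda _ fun i => h.measurable_batch l i))

/-- Functions of finitely many of the random choices have all moments. -/
theorem Setup.memLp_of_factorsThrough [IsProbabilityMeasure μ] (h : Setup A μ α ν k₀ s σ₀ γ δ)
    {E : Type*} [NormedAddCommGroup E] {k : ℕ} {f : Ω → E} (hf : f.FactorsThrough (A.history k))
    (q : ENNReal) : MemLp f q μ := by
  obtain ⟨Φ, rfl⟩ := (Function.factorsThrough_iff f).1 hf
  exact memLp_comp_of_finite (h.measurable_history k) Φ q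

/-- Functions of the parameters of iteration `k` have all moments. -/
theorem Setup.memLp_comp [IsProbabilityMeasure μ] (h : Setup A μ α ν k₀ s σ₀ γ δ)
    {E : Type*} [NormedAddCommGroup E] (k l : ℕ)
    (F : (Fin m → Vec n) → (Fin m → Vec n) → (Fin m → Vec n) → (Fin m → Vec n) → E)
    (q : ENNReal) :
    MemLp (fun ω => F (fun i => A.w k i ω) (fun i => A.v k i ω) (fun i => A.w l i ω)
      (fun i => A.v l i ω)) q μ := by
  refine h.memLp_of_factorsThrough (k := max k l + 1) (fun ω ω' hω => ?_) q
  have h1 := A.w_factorsThrough k (A.history_eq_of_le (by omega) hω)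
  have h2 := A.v_factorsThrough k (A.history_eq_of_le (by omega) hω)
  have h3 := A.w_factorsThrough l (A.history_eq_of_le (by omega) hω)
  have h4 := A.v_factorsThrough l (A.history_eq_of_le (by omega) hω)
  simp only at h1 h2 h3 h4
  simp only [h1, h2, h3, h4]

/-- A communication contracts the expected consensus error. -/
theorem Setup.integral_communication_le [NeZero m] [IsProbabilityMeasure μ]
    (h : Setup A μ α ν k₀ s σ₀ γ δ) (network : IsNetwork A.nbhd) (mixing : IsMixing A.nbhd) {k : ℕ}
    (hk : k₀ ∣ k) {ρ : ℝ}
    (hρ : ∀ i, zeta (commMatrix A.nbhd) ^ 2 + ((1 - (s : ℝ) / n) ^ A.participants ν i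
        + ∑ j ∈ A.nbhd i, (samplingVar ((s : ℝ) / n) (A.participants ν j) / ((A.nbhd j).card : ℝ)
          + selectionVar ((s : ℝ) / n) (A.participants ν j) (A.nbhd j).card)) ≤ ρ) :
    ∫ ω, ∑ i, ‖A.v k i ω - mean fun j => A.w k j ω‖ ^ 2 ∂μ
      ≤ ρ * ∫ ω, spread (fun i => A.w k i ω) ∂μ := by
  obtain ⟨Φ, hΦ⟩ := (Function.factorsThrough_iff _).1 (A.w_factorsThrough k)
  have hW : ∀ ω, (fun i => A.w k i ω) = Φ (A.history k ω) := fun ω => congrFun hΦ ω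
  have hZ : Measurable fun ω => ((fun i => A.select k i ω), (fun i j => A.coords k i j ω)) :=
    (measurable_pi_lambda _ fun i => h.measurable_select k i).prodMk
      (measurable_pi_lambda _ fun i => measurable_pi_lambda _ fun j => h.measurable_coords k i j)
  -- Independence of the past allows integrating over the selections first, with the parameters `Φ
  -- u` held fixed.
  have h1 := integral_indep_eq_integral_integral hZ (h.measurable_history k) (h.past_indep k hk)
    fun z u => ∑ i, ‖pme (Φ u) i (z.1 i) (z.2 i) - mean (Φ u)‖ ^ 2
  simp_rw [h.v_eq_pme hk, hW]
  rw [h1, ← integral_const_mul]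
  refine integral_mono ?_ ?_ fun ω => h.integral_pme_le network mixing hk hρ _
  · exact memLp_one_iff_integrable.1 (memLp_comp_of_finite (h.measurable_history k)
      (fun u => ∫ ω', ∑ i, ‖pme (Φ u) i (A.select k i ω') (fun j => A.coords k i j ω')
        - mean (Φ u)‖ ^ 2 ∂μ) 1)
  · exact memLp_one_iff_integrable.1 (memLp_comp_of_finite (h.measurable_history k)
      (fun u => ρ * spread (Φ u)) 1)

end Iterates

/-! ### Geometric decay of the expected consensus error. -/

section Rate

variable {m n : ℕ} {D : Fin m → Type*} [∀ i, Fintype (D i)] {Ω : Type*} [MeasurableSpace Ω]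
  {μ : Measure Ω} {A : PaME m n D Ω} {α ν : Fin m → ℝ} {k₀ s : ℕ} {σ₀ γ δ : ℝ}

/-- Between communications `v = w`, so only `b + 1` gradient steps separate the two points, each
bounded by the first. -/
theorem Setup.norm_w_sub_communication_le (h : Setup A μ α ν k₀ s σ₀ γ δ) {g : ℝ} (hg : 0 ≤ g)
    (hstep : ∀ k i ω, ‖A.w (k + 1) i ω - A.v k i ω‖ ≤ g * (γ⁻¹) ^ k) (a : ℕ) (i : Fin m) (ω : Ω)
    (b : ℕ) (hb : b < k₀) :
    ‖A.w (a * k₀ + b + 1) i ω - A.v (a * k₀) i ω‖ ≤ (b + 1) * (g * (γ⁻¹) ^ (a * k₀)) := by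
  have hγ0 := h.γ_pos
  have hγ1 : γ⁻¹ ≤ 1 := (inv_lt_one_of_one_lt₀ h.one_lt_γ).le
  induction b with
  | zero => simpa using hstep (a * k₀) i ω
  | succ b ih =>
    have h1 := ih (by omega)
    have h2 := hstep (a * k₀ + b + 1) i ω
    have hdvd : ¬ k₀ ∣ a * k₀ + b + 1 := by
      rw [add_assoc, Nat.dvd_add_right (Dvd.intro_left a rfl)]
      exact Nat.not_dvd_of_pos_of_lt (by omega) (by omega)
    rw [h.v_eq_w hdvd] at h2
    have h3 : g * (γ⁻¹) ^ (a * k₀ + b + 1) ≤ g * (γ⁻¹) ^ (a * k₀) :=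
      mul_le_mul_of_nonneg_left
        (pow_le_pow_of_le_one (by positivity) hγ1 (by omega)) hg
    have h4 := norm_sub_le_norm_sub_add_norm_sub (A.w (a * k₀ + b + 1 + 1) i ω)
      (A.w (a * k₀ + b + 1) i ω) (A.v (a * k₀) i ω)
    push_cast
    rw [← add_assoc]
    linarith

/-- The free weight `η` keeps the coefficient of the main term close to `1`, so the contraction
survives the perturbation. -/
theorem norm_add_sq_le_young {E : Type*} [NormedAddCommGroup E] [InnerProductSpace ℝ E] (x y : E)
    {η : ℝ} (hη : 0 < η) :
    ‖x + y‖ ^ 2 ≤ (1 + η) * ‖x‖ ^ 2 + (1 + η⁻¹) * ‖y‖ ^ 2 := by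
  have h1 := pow_le_pow_left₀ (norm_nonneg _) (norm_add_le x y) 2
  have h2 : 0 ≤ η⁻¹ * (η * ‖x‖ - ‖y‖) ^ 2 := by positivity
  have h3 : η⁻¹ * (η * ‖x‖ - ‖y‖) ^ 2 = η * ‖x‖ ^ 2 - 2 * ‖x‖ * ‖y‖ + η⁻¹ * ‖y‖ ^ 2 := by
    field_simp
    ring
  nlinarith

/-- The spread is minimal at its own centre, so it may be measured from the mean before the
communication, the centre used in the contraction estimate. -/
theorem Setup.spread_le_communication [NeZero m] (h : Setup A μ α ν k₀ s σ₀ γ δ) {g : ℝ}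
    (hg : 0 ≤ g) (hstep : ∀ k i ω, ‖A.w (k + 1) i ω - A.v k i ω‖ ≤ g * (γ⁻¹) ^ k) {η : ℝ}
    (hη : 0 < η) (a b : ℕ) (hb : b < k₀) (ω : Ω) :
    spread (fun i => A.w (a * k₀ + b + 1) i ω)
      ≤ (1 + η) * ∑ i, ‖A.v (a * k₀) i ω - mean fun j => A.w (a * k₀) j ω‖ ^ 2
        + (1 + η⁻¹) * m * (k₀ * g) ^ 2 * ((γ⁻¹) ^ (2 * k₀)) ^ a := by
  have hγ0 := h.γ_pos
  refine (spread_le _ (mean fun j => A.w (a * k₀) j ω)).trans ?_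
  have hi : ∀ i, ‖A.w (a * k₀ + b + 1) i ω - mean fun j => A.w (a * k₀) j ω‖ ^ 2
      ≤ (1 + η) * ‖A.v (a * k₀) i ω - mean fun j => A.w (a * k₀) j ω‖ ^ 2
        + (1 + η⁻¹) * ((k₀ * g) ^ 2 * ((γ⁻¹) ^ (2 * k₀)) ^ a) := by
    intro i
    have h1 := norm_add_sq_le_young (A.v (a * k₀) i ω - mean fun j => A.w (a * k₀) j ω)
      (A.w (a * k₀ + b + 1) i ω - A.v (a * k₀) i ω) hη
    rw [add_comm, sub_add_sub_cancel] at h1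
    refine h1.trans (add_le_add le_rfl (mul_le_mul_of_nonneg_left ?_ (by positivity)))
    have h2 := h.norm_w_sub_communication_le hg hstep a i ω b hb
    have h3 : ((b : ℝ) + 1) * (g * (γ⁻¹) ^ (a * k₀)) ≤ k₀ * (g * (γ⁻¹) ^ (a * k₀)) :=
      mul_le_mul_of_nonneg_right (by exact_mod_cast hb) (by positivity)
    refine (pow_le_pow_left₀ (norm_nonneg _) (h2.trans h3) 2).trans (le_of_eq ?_)
    rw [← mul_assoc, mul_pow, ← pow_mul, ← pow_mul]
    congr 2
    ring
  refine (Finset.sum_le_sum fun i _ => hi i).trans (le_of_eq ?_)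
  rw [Finset.sum_add_distrib, ← Finset.mul_sum, Finset.sum_const, Finset.card_univ,
    Fintype.card_fin, nsmul_eq_mul]
  ring

theorem spread_zero : spread (fun _ : Fin m => (0 : Vec n)) = 0 := by
  simp [spread, mean]

/-- The expected consensus error decays geometrically, and faster than the penalties grow. -/
theorem Setup.exists_integral_spread_le [NeZero m] [IsProbabilityMeasure μ]
    (h : Setup A μ α ν k₀ s σ₀ γ δ) (network : IsNetwork A.nbhd) (losses : A.RegularLosses)
    (mixing : IsMixing A.nbhd) (lipschitz : A.LipschitzGradients α δ) :
    ∃ K r : ℝ, 0 ≤ K ∧ 0 < r ∧ r < γ⁻¹ ∧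
      ∀ k, ∫ ω, spread (fun i => A.w k i ω) ∂μ ≤ K * r ^ k := by
  obtain ⟨g, hg, hstep⟩ := h.exists_step_bound losses lipschitz
  obtain ⟨ρ, hρ0, hρL, hρ⟩ := h.exists_contraction_factor
  have hγ0 := h.γ_pos
  have hγi0 : 0 < γ⁻¹ := by positivity
  have hγ1 : γ⁻¹ < 1 := inv_lt_one_of_one_lt₀ h.one_lt_γ
  have hk₀ := h.k₀_pos
  rw [← inv_pow] at hρL
  set L := γ⁻¹ ^ k₀ with hL
  have hL1 : L < 1 := pow_lt_one₀ hγi0.le hγ1 hk₀.ne'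
  have hL0 : 0 < L := by positivity
  -- Small enough that `(1 + η) * ρ` stays below `L`; the `+ 1` covers `ρ = 0`.
  set η := (L - ρ) / (2 * (ρ + 1)) with hη
  have hη0 : 0 < η := div_pos (by linarith) (by linarith)
  have hηρ : (1 + η) * ρ < L := by
    have h1 : η * (ρ + 1) = (L - ρ) / 2 := by
      rw [hη]; field_simp
    linarith
  set β := γ⁻¹ ^ (2 * k₀) with hβ
  have hβL : β < L := by
    rw [hβ, two_mul, pow_add]
    exact mul_lt_of_lt_one_left hL0 hL1
  have hβ0 : 0 < β := by positivity
  obtain ⟨τ, hτ1, hτL⟩ := exists_between (max_lt hηρ hβL)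
  have hτρ := (le_max_left _ _).trans_lt hτ1
  have hτβ := (le_max_right _ _).trans_lt hτ1
  have hτ0 : 0 < τ := hβ0.trans hτβ
  set C := (1 + η⁻¹) * m * (k₀ * g) ^ 2 with hC
  have hC0 : 0 ≤ C := by positivity
  set X : ℕ → ℝ := fun k => ∫ ω, spread (fun i => A.w k i ω) ∂μ with hX
  have hrec : ∀ a b, b < k₀ → X (a * k₀ + b + 1) ≤ (1 + η) * ρ * X (a * k₀) + C * β ^ a := by
    intro a b hb
    have hcomm := h.integral_communication_le network mixing (Dvd.intro_left a rfl) hρ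
    have hi1 : Integrable (fun ω => spread fun i => A.w (a * k₀ + b + 1) i ω) μ :=
      memLp_one_iff_integrable.1 (h.memLp_comp (a * k₀ + b + 1) 0 (fun W _ _ _ => spread W) 1)
    have hi2 : Integrable (fun ω =>
        ∑ i, ‖A.v (a * k₀) i ω - mean fun j => A.w (a * k₀) j ω‖ ^ 2) μ :=
      memLp_one_iff_integrable.1 (h.memLp_comp (a * k₀) 0
        (fun W V _ _ => ∑ i, ‖V i - mean W‖ ^ 2) 1)
    have h1 := integral_mono hi1 ((hi2.const_mul (1 + η)).add (integrable_const (C * β ^ a)))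
      (fun ω => h.spread_le_communication hg hstep hη0 a b hb ω)
    simp only [Pi.add_apply] at h1
    rw [integral_add (hi2.const_mul _) (integrable_const _), integral_const_mul] at h1
    simp only [integral_const, probReal_univ, one_smul] at h1
    have h2 := mul_le_mul_of_nonneg_left hcomm (by positivity : 0 ≤ 1 + η)
    simp only [hX]
    linarith
  -- The solution of `(1 + η) * ρ * K + C = K * τ`, which closes the induction over periods since `β
  -- < τ`.
  set K := C / (τ - (1 + η) * ρ) with hK
  have hd : 0 < τ - (1 + η) * ρ := by linarith
  have hK0 : 0 ≤ K := by positivity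
  have hKC : (1 + η) * ρ * K + C = K * τ := by
    rw [hK]; field_simp; ring
  have hbd : ∀ a b, X (a * k₀) ≤ K * τ ^ a → b < k₀ → X (a * k₀ + b + 1) ≤ K * τ ^ (a + 1) := by
    intro a b ha hb
    have h1 := hrec a b hb
    have h2 : C * β ^ a ≤ C * τ ^ a :=
      mul_le_mul_of_nonneg_left (pow_le_pow_left₀ hβ0.le hτβ.le a) hC0
    have h3 := mul_le_mul_of_nonneg_left ha (by positivity : 0 ≤ (1 + η) * ρ)
    calc _ ≤ ((1 + η) * ρ * K + C) * τ ^ a := by linarith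
      _ = _ := by rw [hKC]; ring
  have hX0 : X 0 = 0 := by
    have : ∀ ω, spread (fun i => A.w 0 i ω) = 0 := fun ω => spread_zero
    simp only [hX, this, integral_zero]
  have hper : ∀ a, X (a * k₀) ≤ K * τ ^ a := by
    intro a
    induction a with
    | zero => rw [zero_mul, hX0]; positivity
    | succ a ih =>
      have := hbd a (k₀ - 1) ih (by omega)
      have e : (a + 1) * k₀ = a * k₀ + (k₀ - 1) + 1 := by
        rw [add_mul, one_mul]; omega
      rwa [e]
  set r := τ ^ ((k₀ : ℝ)⁻¹) with hr
  have hr0 : 0 < r := Real.rpow_pos_of_pos hτ0 _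
  have hrk : r ^ k₀ = τ := Real.rpow_inv_natCast_pow hτ0.le hk₀.ne'
  have hrγ : r < γ⁻¹ := by
    refine lt_of_pow_lt_pow_left₀ k₀ hγi0.le ?_
    rw [hrk]; exact hτL
  refine ⟨K, r, hK0, hr0, hrγ, fun k => ?_⟩
  change X k ≤ _
  rcases Nat.eq_zero_or_pos k with rfl | hk
  · rw [hX0]; positivity
  -- The shift by one assigns a communication time to the preceding period, where the bound already
  -- has the exponent `a + 1`; then `k ≤ (a + 1) * k₀`.
  · have e : k = ((k - 1) / k₀) * k₀ + (k - 1) % k₀ + 1 := by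
      rw [mul_comm, Nat.div_add_mod]; omega
    have h1 := hbd ((k - 1) / k₀) ((k - 1) % k₀) (hper _) (Nat.mod_lt _ hk₀)
    rw [← e] at h1
    refine h1.trans (mul_le_mul_of_nonneg_left ?_ hK0)
    rw [← hrk, ← pow_mul]
    refine pow_le_pow_of_le_one hr0.le (by linarith) ?_
    have := Nat.mod_lt (k - 1) hk₀
    have e2 : k₀ * ((k - 1) / k₀ + 1) = ((k - 1) / k₀) * k₀ + k₀ := by ring
    rw [e2]
    omega

end Rate

/-! ### From geometric decay to almost sure convergence. -/

section Convergence

variable {m n : ℕ} {D : Fin m → Type*} [∀ i, Fintype (D i)] {Ω : Type*} [MeasurableSpace Ω]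
  {μ : Measure Ω} {A : PaME m n D Ω} {α ν : Fin m → ℝ} {k₀ s : ℕ} {σ₀ γ δ : ℝ}

theorem mean_mem_box [NeZero m] {W : Fin m → Vec n} {r : ℝ} (hr : 0 ≤ r)
    (h : ∀ i, W i ∈ box n r) : mean W ∈ box n r := by
  refine (supNorm_le_iff hr).2 fun l => ?_
  have hm : (0 : ℝ) < m := by exact_mod_cast NeZero.pos m
  have h1 : |∑ i, W i l| ≤ m * r := by
    refine (Finset.abs_sum_le_sum_abs _ _).trans ?_
    have := Finset.sum_le_card_nsmul Finset.univ (fun i => |W i l|) r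
      fun i _ => (supNorm_le_iff hr).1 (h i) l
    simpa using this
  have h2 : mean W l = (1 / (m : ℝ)) * ∑ i, W i l := by simp [mean]
  rw [h2, abs_mul, abs_of_pos (by positivity), one_div, inv_mul_le_iff₀ hm]
  exact h1

/-- By AM–GM, `‖Y‖ ≤ ‖Y‖ ^ 2 / (2 * c) + c / 2`. With `c = √r ^ k`, second moments `O(r ^ k)` give
first moments `O(√r ^ k)`, still summable. -/
theorem integral_norm_le_of_integral_norm_sq_le {E : Type*} [NormedAddCommGroup E]
    [IsProbabilityMeasure μ] {Y : Ω → E} (hY : MemLp Y 2 μ) {c K : ℝ} (hc : 0 < c)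
    (h : ∫ ω, ‖Y ω‖ ^ 2 ∂μ ≤ K * c ^ 2) : ∫ ω, ‖Y ω‖ ∂μ ≤ (K + 1) / 2 * c := by
  have h1 : Integrable (fun ω => ‖Y ω‖ ^ 2) μ := hY.integrable_norm_pow two_ne_zero
  have h2 : Integrable (fun ω => ‖Y ω‖) μ := (hY.integrable one_le_two).norm
  have h3 : ∀ ω, ‖Y ω‖ ≤ (2 * c)⁻¹ * ‖Y ω‖ ^ 2 + c / 2 := by
    intro ω
    have : (2 * c)⁻¹ * ‖Y ω‖ ^ 2 + c / 2 - ‖Y ω‖ = (2 * c)⁻¹ * (‖Y ω‖ - c) ^ 2 := by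
      field_simp
      ring
    have : 0 ≤ (2 * c)⁻¹ * (‖Y ω‖ - c) ^ 2 := by positivity
    linarith
  have h4 := integral_mono h2 ((h1.const_mul (2 * c)⁻¹).add (integrable_const (c / 2))) h3
  simp only [Pi.add_apply] at h4
  rw [integral_add (h1.const_mul _) (integrable_const _), integral_const_mul] at h4
  simp only [integral_const, probReal_univ, one_smul] at h4
  have h5 := mul_le_mul_of_nonneg_left h (by positivity : 0 ≤ (2 * c)⁻¹)
  have h6 : (2 * c)⁻¹ * (K * c ^ 2) = K / 2 * c := by field_simp
  linarith

theorem tendsto_integral_of_norm_le_const [IsProbabilityMeasure μ] {G : Type*}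
    [NormedAddCommGroup G] [NormedSpace ℝ G] {F : ℕ → Ω → G} {f : Ω → G} (C : ℝ)
    (hF : ∀ k, AEStronglyMeasurable (F k) μ) (hC : ∀ k, ∀ᵐ ω ∂μ, ‖F k ω‖ ≤ C)
    (hlim : ∀ᵐ ω ∂μ, Tendsto (fun k => F k ω) atTop (𝓝 (f ω))) :
    Tendsto (fun k => ∫ ω, F k ω ∂μ) atTop (𝓝 (∫ ω, f ω ∂μ)) :=
  tendsto_integral_of_dominated_convergence (fun _ => C) hF (integrable_const C) hC hlim

/-- The expected distances between the aggregated parameters, the parameters, and their average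
decay geometrically. -/
theorem Setup.exists_integral_norm_le [NeZero m] [IsProbabilityMeasure μ]
    (h : Setup A μ α ν k₀ s σ₀ γ δ) {K r : ℝ} (hK : 0 ≤ K) (hr : 0 < r)
    (hr1 : r < 1) (hspread : ∀ k, ∫ ω, spread (fun i => A.w k i ω) ∂μ ≤ K * r ^ k) :
    ∃ M q : ℝ, 0 ≤ M ∧ 0 < q ∧ q < 1 ∧ ∀ k i, ∫ ω, ‖A.w k i ω - A.v k i ω‖ ∂μ ≤ M * q ^ k ∧
      ∫ ω, ‖A.w k i ω - A.avg k ω‖ ∂μ ≤ M * q ^ k := by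
  have hq : ∀ k, (√r ^ k) ^ 2 = r ^ k := fun k => by
    rw [← pow_mul, mul_comm, pow_mul, Real.sq_sqrt hr.le]
  have hint : ∀ k, Integrable (fun ω => spread (fun i => A.w k i ω)) μ := fun k =>
    memLp_one_iff_integrable.1 (h.memLp_comp k 0 (fun W _ _ _ => spread W) 1)
  refine ⟨(4 * K + 1) / 2, √r, by positivity, Real.sqrt_pos.2 hr, ?_, fun k i => ⟨?_, ?_⟩⟩
  · rw [Real.sqrt_lt' one_pos]; simpa using hr1
  · have hY : MemLp (fun ω => A.w k i ω - A.v k i ω) 2 μ :=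
      h.memLp_comp k 0 (fun W V _ _ => W i - V i) 2
    refine integral_norm_le_of_integral_norm_sq_le hY (by positivity) ?_
    rw [hq]
    have h1 := integral_mono (hY.integrable_norm_pow two_ne_zero) ((hint k).const_mul 4)
      fun ω => by
        simp only
        rw [norm_sub_rev]
        exact A.norm_aggregate_sub_self_sq_le k (fun j => A.w k j ω) i ω
    rw [integral_const_mul] at h1
    linarith [hspread k]
  · have hY : MemLp (fun ω => A.w k i ω - A.avg k ω) 2 μ :=
      h.memLp_comp k 0 (fun W _ _ _ => W i - mean W) 2
    refine integral_norm_le_of_integral_norm_sq_le hY (by positivity) ?_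
    rw [hq]
    have h1 := integral_mono (hY.integrable_norm_pow two_ne_zero) (hint k)
      fun ω => norm_sub_mean_sq_le (fun j => A.w k j ω) i
    have h2 : 0 ≤ K * r ^ k := by positivity
    linarith [hspread k]

theorem Setup.integral_norm_step_le [NeZero m] [IsProbabilityMeasure μ]
    (h : Setup A μ α ν k₀ s σ₀ γ δ) {g : ℝ}
    (hstep : ∀ k i ω, ‖A.w (k + 1) i ω - A.v k i ω‖ ≤ g * (γ⁻¹) ^ k) (k : ℕ) (i : Fin m) :
    ∫ ω, ‖A.w (k + 1) i ω - A.w k i ω‖ ∂μ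
      ≤ g * (γ⁻¹) ^ k + ∫ ω, ‖A.w k i ω - A.v k i ω‖ ∂μ := by
  have h1 : Integrable (fun ω => ‖A.w (k + 1) i ω - A.w k i ω‖) μ :=
    memLp_one_iff_integrable.1 (h.memLp_comp k (k + 1) (fun W _ W' _ => ‖W' i - W i‖) 1)
  have h2 : Integrable (fun ω => ‖A.w k i ω - A.v k i ω‖) μ :=
    memLp_one_iff_integrable.1 (h.memLp_comp k 0 (fun W V _ _ => ‖W i - V i‖) 1)
  have h3 := integral_mono h1 ((integrable_const (g * (γ⁻¹) ^ k)).add h2) fun ω => by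
    simp only [Pi.add_apply]
    have := norm_sub_le_norm_sub_add_norm_sub (A.w (k + 1) i ω) (A.v k i ω) (A.w k i ω)
    rw [norm_sub_rev (A.v k i ω)] at this
    linarith [hstep k i ω]
  simp only [Pi.add_apply] at h3
  rw [integral_add (integrable_const _) h2] at h3
  simpa using h3

theorem Setup.integral_norm_aggregated_step_le [IsProbabilityMeasure μ]
    (h : Setup A μ α ν k₀ s σ₀ γ δ) (k : ℕ) (i : Fin m) :
    ∫ ω, ‖A.v (k + 1) i ω - A.v k i ω‖ ∂μ
      ≤ ∫ ω, ‖A.w (k + 1) i ω - A.v (k + 1) i ω‖ ∂μ + ∫ ω, ‖A.w (k + 1) i ω - A.w k i ω‖ ∂μ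
        + ∫ ω, ‖A.w k i ω - A.v k i ω‖ ∂μ := by
  have h0 : Integrable (fun ω => ‖A.v (k + 1) i ω - A.v k i ω‖) μ :=
    memLp_one_iff_integrable.1 (h.memLp_comp k (k + 1) (fun _ V _ V' => ‖V' i - V i‖) 1)
  have h1 : Integrable (fun ω => ‖A.w (k + 1) i ω - A.w k i ω‖) μ :=
    memLp_one_iff_integrable.1 (h.memLp_comp k (k + 1) (fun W _ W' _ => ‖W' i - W i‖) 1)
  have h2 : ∀ k, Integrable (fun ω => ‖A.w k i ω - A.v k i ω‖) μ := fun k =>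
    memLp_one_iff_integrable.1 (h.memLp_comp k 0 (fun W V _ _ => ‖W i - V i‖) 1)
  have h3 : Integrable (fun ω => ‖A.w (k + 1) i ω - A.v (k + 1) i ω‖
      + ‖A.w (k + 1) i ω - A.w k i ω‖) μ := (h2 (k + 1)).add h1
  rw [← integral_add (h2 (k + 1)) h1, ← integral_add h3 (h2 k)]
  refine integral_mono h0 (h3.add (h2 k)) fun ω => ?_
  simp only
  have e1 := norm_sub_le_norm_sub_add_norm_sub (A.v (k + 1) i ω) (A.w (k + 1) i ω) (A.v k i ω)
  have e2 := norm_sub_le_norm_sub_add_norm_sub (A.w (k + 1) i ω) (A.w k i ω) (A.v k i ω)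
  rw [norm_sub_rev (A.v (k + 1) i ω) (A.w (k + 1) i ω)] at e1
  linarith

/-- All nodes converge almost surely to a common random vector. -/
theorem Setup.exists_ae_tendsto [NeZero m] [IsProbabilityMeasure μ]
    (h : Setup A μ α ν k₀ s σ₀ γ δ)
    (hv : ∀ i, Summable fun k => ∫ ω, ‖A.w k i ω - A.v k i ω‖ ∂μ)
    (havg : ∀ i, Summable fun k => ∫ ω, ‖A.w k i ω - A.avg k ω‖ ∂μ)
    (hw : ∀ i, Summable fun k => ∫ ω, ‖A.w (k + 1) i ω - A.w k i ω‖ ∂μ) :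
    ∃ x : Ω → Vec n, StronglyMeasurable x ∧ ∀ᵐ ω ∂μ,
      Tendsto (fun k => A.avg k ω) atTop (𝓝 (x ω)) ∧
      ∀ i, Tendsto (fun k => A.w k i ω) atTop (𝓝 (x ω)) ∧
        Tendsto (fun k => A.v k i ω) atTop (𝓝 (x ω)) := by
  have i1 : ∀ k i, Integrable (fun ω => A.w k i ω - A.v k i ω) μ := fun k i =>
    memLp_one_iff_integrable.1 (h.memLp_comp k 0 (fun W V _ _ => W i - V i) 1)
  have i2 : ∀ k i, Integrable (fun ω => A.w k i ω - A.avg k ω) μ := fun k i =>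
    memLp_one_iff_integrable.1 (h.memLp_comp k 0 (fun W _ _ _ => W i - mean W) 1)
  have i3 : ∀ k i, Integrable (fun ω => A.w (k + 1) i ω - A.w k i ω) μ := fun k i =>
    memLp_one_iff_integrable.1 (h.memLp_comp k (k + 1) (fun W _ W' _ => W' i - W i) 1)
  have a1 := ae_all_iff.2 fun i => ae_summable_norm (fun k => i1 k i) (hv i)
  have a2 := ae_all_iff.2 fun i => ae_summable_norm (fun k => i2 k i) (havg i)
  -- One node suffices for the Cauchy property; the average, and through it the other nodes, follow.
  have a3 := ae_summable_norm (fun k => i3 k 0) (hw 0)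
  have hex : ∀ᵐ ω ∂μ, ∃ x, Tendsto (fun k => A.w k 0 ω) atTop (𝓝 x) := by
    filter_upwards [a3] with ω h3
    refine cauchySeq_tendsto_of_complete (cauchySeq_of_summable_dist ?_)
    simpa only [dist_eq_norm, norm_sub_rev (A.w _ 0 ω) (A.w (_ + 1) 0 ω)] using h3
  obtain ⟨x, hx, hlim⟩ := exists_stronglyMeasurable_limit_of_tendsto_ae
    (fun k => (h.memLp_comp k 0 (fun W _ _ _ => W 0) 1 (μ := μ)).1) hex
  refine ⟨x, hx, ?_⟩
  filter_upwards [a1, a2, hlim] with ω h1 h2 h3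
  have t1 : ∀ i, Tendsto (fun k => A.w k i ω - A.v k i ω) atTop (𝓝 0) := fun i =>
    tendsto_zero_iff_norm_tendsto_zero.2 (h1 i).tendsto_atTop_zero
  have t2 : ∀ i, Tendsto (fun k => A.w k i ω - A.avg k ω) atTop (𝓝 0) := fun i =>
    tendsto_zero_iff_norm_tendsto_zero.2 (h2 i).tendsto_atTop_zero
  have tavg : Tendsto (fun k => A.avg k ω) atTop (𝓝 (x ω)) := by
    simpa using h3.sub (t2 0)
  refine ⟨tavg, fun i => ?_⟩
  have tw : Tendsto (fun k => A.w k i ω) atTop (𝓝 (x ω)) := by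
    simpa using (t2 i).add tavg
  exact ⟨tw, by simpa using tw.sub (t1 i)⟩

/-- The penalty part of the merit function vanishes in the limit. -/
theorem Setup.tendsto_penalty [NeZero m] [IsProbabilityMeasure μ]
    (h : Setup A μ α ν k₀ s σ₀ γ δ) (hσ : 0 < σ₀) {K r : ℝ} (hr : 0 < r)
    (hrγ : r < γ⁻¹) (hspread : ∀ k, ∫ ω, spread (fun i => A.w k i ω) ∂μ ≤ K * r ^ k) :
    Tendsto (fun k => ∫ ω, ∑ i, A.penalty k i * (A.participants ν i : ℝ) / 2
      * ‖A.w k i ω - A.v k i ω‖ ^ 2 ∂μ) atTop (𝓝 0) := by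
  have hγ := h.γ_pos
  have hpen : ∀ k i, A.penalty k i = γ ^ k * σ₀ := fun k i => by
    rw [PaME.penalty, h.growth, h.penalty₀]
  set c := ∑ i, 2 * σ₀ * (A.participants ν i : ℝ) with hc
  have hc0 : 0 ≤ c := Finset.sum_nonneg fun i _ => by positivity
  have hint : ∀ k, Integrable (fun ω => spread (fun i => A.w k i ω)) μ := fun k =>
    memLp_one_iff_integrable.1 (h.memLp_comp k 0 (fun W _ _ _ => spread W) 1)
  -- The penalties grow like `γ ^ k` and the consensus error decays like `r ^ k`; the product still
  -- vanishes.
  have hγr : γ * r < 1 := by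
    rw [← mul_inv_cancel₀ hγ.ne']
    exact mul_lt_mul_of_pos_left hrγ hγ
  have hlim : Tendsto (fun k => c * K * (γ * r) ^ k) atTop (𝓝 0) := by
    simpa using (tendsto_pow_atTop_nhds_zero_of_lt_one (by positivity) hγr).const_mul (c * K)
  refine squeeze_zero (fun k => ?_) (fun k => ?_) hlim
  · refine integral_nonneg fun ω => Finset.sum_nonneg fun i _ => ?_
    rw [hpen]
    positivity
  · have hi : Integrable (fun ω => ∑ i, A.penalty k i * (A.participants ν i : ℝ) / 2
        * ‖A.w k i ω - A.v k i ω‖ ^ 2) μ :=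
      memLp_one_iff_integrable.1 (h.memLp_comp k 0 (fun W V _ _ =>
        ∑ i, A.penalty k i * (A.participants ν i : ℝ) / 2 * ‖W i - V i‖ ^ 2) 1)
    have h1 := integral_mono hi ((hint k).const_mul (c * γ ^ k)) fun ω => by
      simp only
      rw [hc, Finset.sum_mul, Finset.sum_mul]
      refine Finset.sum_le_sum fun i _ => ?_
      have h2 := A.norm_aggregate_sub_self_sq_le k (fun j => A.w k j ω) i ω
      rw [norm_sub_rev] at h2
      rw [hpen]
      calc _ ≤ γ ^ k * σ₀ * (A.participants ν i : ℝ) / 2 * (4 * spread fun j => A.w k j ω) :=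
            mul_le_mul_of_nonneg_left h2 (by positivity)
        _ = _ := by ring
    rw [integral_const_mul] at h1
    refine h1.trans ((mul_le_mul_of_nonneg_left (hspread k) (by positivity)).trans
      (le_of_eq ?_))
    rw [mul_pow]
    ring

end Convergence

end DFL

end

/-! ### Passage to the limit in the expectations. -/

theorem theorem3 {m n : ℕ} {D : Fin m → Type*} [∀ i, Fintype (D i)]
    {Ω : Type*} [MeasurableSpace Ω] (μ : Measure Ω) [IsProbabilityMeasure μ]
    (A : DFL.PaME m n D Ω) (α ν : Fin m → ℝ) (k₀ s : ℕ) (σ₀ γ δ : ℝ)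
    (network : DFL.IsNetwork A.nbhd) (losses : A.RegularLosses)
    (mixing : DFL.IsMixing A.nbhd) (lipschitz : A.LipschitzGradients α δ)
    (setup : DFL.Setup A μ α ν k₀ s σ₀ γ δ) :
    -- all expectations below are those of integrable random variables
    (∀ k i, MemLp (A.w k i) 2 μ ∧ MemLp (A.v k i) 2 μ ∧
      Integrable (fun ω => A.localLoss i (A.w k i ω)) μ ∧
      Integrable (fun ω => A.globalLoss (A.avg k ω)) μ) ∧
    (∀ i,
      Tendsto (fun k => ∫ ω, ‖A.w (k + 1) i ω - A.w k i ω‖ ∂μ) atTop (𝓝 0) ∧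
      Tendsto (fun k => ∫ ω, ‖A.v (k + 1) i ω - A.v k i ω‖ ∂μ) atTop (𝓝 0) ∧
      Tendsto (fun k => ∫ ω, ‖A.w k i ω - A.v k i ω‖ ∂μ) atTop (𝓝 0)) ∧
    ∃ avgLim : Ω → DFL.Vec n, MemLp avgLim 2 μ ∧
      Integrable (fun ω => A.globalLoss (avgLim ω)) μ ∧
      Tendsto (fun k => ∫ ω, ‖A.avg k ω - avgLim ω‖ ^ 2 ∂μ) atTop (𝓝 0) ∧
      Tendsto (fun k => ∫ ω, A.avg k ω ∂μ) atTop (𝓝 (∫ ω, avgLim ω ∂μ)) ∧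
      Tendsto (fun k i => ∫ ω, A.w k i ω ∂μ) atTop (𝓝 fun _ => ∫ ω, avgLim ω ∂μ) ∧
      Tendsto (fun k i => ∫ ω, A.v k i ω ∂μ) atTop (𝓝 fun _ => ∫ ω, avgLim ω ∂μ) ∧
      Tendsto (A.merit μ (A.participants ν)) atTop
        (𝓝 (∫ ω, A.globalLoss (avgLim ω) ∂μ)) ∧
      (∀ η C E : ℝ, 1 < η →
        Tendsto (A.meritTilde μ (A.participants ν) γ η C E) atTop
          (𝓝 (∫ ω, A.globalLoss (avgLim ω) ∂μ))) ∧
      Tendsto (fun k => ∫ ω, A.globalLoss (A.avg k ω) ∂μ) atTop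
        (𝓝 (∫ ω, A.globalLoss (avgLim ω) ∂μ)) := by
  have : NeZero m := ⟨by
    obtain ⟨i⟩ := network.connected.nonempty
    exact (i.pos).ne'⟩
  have hγ := setup.one_lt_γ
  have hγ0 := setup.γ_pos
  have hγi0 : 0 < γ⁻¹ := by positivity
  have hγ1 : γ⁻¹ < 1 := inv_lt_one_of_one_lt₀ hγ
  have hδ := lipschitz.δ_pos.le
  have hσ := setup.σ₀_pos lipschitz
  obtain ⟨K, r, hK, hr, hrγ, hspread⟩ :=
    setup.exists_integral_spread_le network losses mixing lipschitz
  obtain ⟨g, -, hstep⟩ := setup.exists_step_bound losses lipschitz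
  obtain ⟨M, q, hM, hq0, hq1, hMq⟩ :=
    setup.exists_integral_norm_le hK hr (hrγ.trans hγ1) hspread
  have sq : Summable fun k : ℕ => M * q ^ k :=
    (summable_geometric_of_lt_one hq0.le hq1).mul_left M
  have sγ : Summable fun k : ℕ => g * γ⁻¹ ^ k :=
    (summable_geometric_of_lt_one hγi0.le hγ1).mul_left g
  have nn : ∀ Y : Ω → DFL.Vec n, 0 ≤ ∫ ω, ‖Y ω‖ ∂μ := fun Y =>
    integral_nonneg fun ω => norm_nonneg _
  have s1 : ∀ i, Summable fun k => ∫ ω, ‖A.w k i ω - A.v k i ω‖ ∂μ := fun i =>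
    sq.of_nonneg_of_le (fun k => nn _) fun k => (hMq k i).1
  have s2 : ∀ i, Summable fun k => ∫ ω, ‖A.w k i ω - A.avg k ω‖ ∂μ := fun i =>
    sq.of_nonneg_of_le (fun k => nn _) fun k => (hMq k i).2
  have s3 : ∀ i, Summable fun k => ∫ ω, ‖A.w (k + 1) i ω - A.w k i ω‖ ∂μ := fun i =>
    (sγ.add (s1 i)).of_nonneg_of_le (fun k => nn _)
      fun k => setup.integral_norm_step_le hstep k i
  obtain ⟨x, hx, hlim⟩ := setup.exists_ae_tendsto s1 s2 s3
  have wbox := setup.w_mem_box losses lipschitz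
  have vbox := setup.v_mem_box losses lipschitz
  have abox : ∀ k ω, A.avg k ω ∈ DFL.box n δ := fun k ω =>
    DFL.mean_mem_box hδ fun i => wbox k i ω
  -- The box is closed, so the limit inherits the bounds that give its integrability and the
  -- constant dominating functions.
  have xbox : ∀ᵐ ω ∂μ, x ω ∈ DFL.box n δ := by
    filter_upwards [hlim] with ω h
    exact (DFL.isCompact_box n δ).isClosed.mem_of_tendsto h.1 (.of_forall fun k => abox k ω)
  have cg := losses.continuous_globalLoss
  obtain ⟨R, hR⟩ := DFL.exists_norm_le_on_box (continuous_id (X := DFL.Vec n)) δ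
  obtain ⟨Cg, hCg⟩ := DFL.exists_norm_le_on_box cg δ
  have mw : ∀ k i q, MemLp (A.w k i) q μ := fun k i q =>
    setup.memLp_comp k 0 (fun W _ _ _ => W i) q
  have mv : ∀ k i q, MemLp (A.v k i) q μ := fun k i q =>
    setup.memLp_comp k 0 (fun _ V _ _ => V i) q
  have ma : ∀ k q, MemLp (A.avg k) q μ := fun k q =>
    setup.memLp_comp k 0 (fun W _ _ _ => DFL.mean W) q
  have mg : ∀ k, Integrable (fun ω => A.globalLoss (A.avg k ω)) μ := fun k =>
    memLp_one_iff_integrable.1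
      (setup.memLp_comp k 0 (fun W _ _ _ => A.globalLoss (DFL.mean W)) 1)
  have ml : ∀ k, Integrable (fun ω => ∑ i, A.localLoss i (A.w k i ω)) μ := fun k =>
    memLp_one_iff_integrable.1
      (setup.memLp_comp k 0 (fun W _ _ _ => ∑ i, A.localLoss i (W i)) 1)
  have merit_lim : Tendsto (A.merit μ (A.participants ν)) atTop
      (𝓝 (∫ ω, A.globalLoss (x ω) ∂μ)) := by
    choose Cl hCl using fun i => DFL.exists_norm_le_on_box (losses.continuous_localLoss i) δ
    have h1 : Tendsto (fun k => ∫ ω, ∑ i, A.localLoss i (A.w k i ω) ∂μ) atTop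
        (𝓝 (∫ ω, A.globalLoss (x ω) ∂μ)) := by
      refine DFL.tendsto_integral_of_norm_le_const (∑ i, Cl i) (fun k => (ml k).1)
        (fun k => .of_forall fun ω => ?_) ?_
      · exact (norm_sum_le _ _).trans (Finset.sum_le_sum fun i _ => hCl i _ (wbox k i ω))
      · filter_upwards [hlim] with ω h
        exact tendsto_finsetSum _ fun i _ =>
          ((losses.continuous_localLoss i).tendsto _).comp (h.2 i).1
    have h2 := h1.add (setup.tendsto_penalty hσ hr hrγ hspread)
    rw [add_zero] at h2
    refine h2.congr fun k => ?_
    have mp : Integrable (fun ω => ∑ i, A.penalty k i * (A.participants ν i : ℝ) / 2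
        * ‖A.w k i ω - A.v k i ω‖ ^ 2) μ :=
      memLp_one_iff_integrable.1 (setup.memLp_comp k 0 (fun W V _ _ =>
        ∑ i, A.penalty k i * (A.participants ν i : ℝ) / 2 * ‖W i - V i‖ ^ 2) 1)
    rw [← integral_add (ml k) mp, DFL.PaME.merit]
    simp only [Finset.sum_add_distrib]
  refine ⟨fun k i => ⟨mw k i 2, mv k i 2, ?_, mg k⟩,
    fun i => ⟨(s3 i).tendsto_atTop_zero, ?_, (s1 i).tendsto_atTop_zero⟩,
    x, ?_, ?_, ?_, ?_, ?_, ?_, merit_lim, ?_, ?_⟩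
  · exact memLp_one_iff_integrable.1
      (setup.memLp_comp k 0 (fun W _ _ _ => A.localLoss i (W i)) 1)
  · have h1 := ((tendsto_add_atTop_iff_nat 1).2 (s1 i).tendsto_atTop_zero).add
      ((s3 i).tendsto_atTop_zero) |>.add (s1 i).tendsto_atTop_zero
    simp only [add_zero] at h1
    exact squeeze_zero (fun k => nn _) (fun k => setup.integral_norm_aggregated_step_le k i) h1
  · refine MemLp.of_bound hx.aestronglyMeasurable R ?_
    filter_upwards [xbox] with ω h using hR _ h
  · refine Integrable.of_bound (cg.comp_stronglyMeasurable hx).aestronglyMeasurable Cg ?_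
    filter_upwards [xbox] with ω h using hCg _ h
  · have h0 : ∫ _, (0 : ℝ) ∂μ = 0 := integral_zero _ _
    rw [← h0]
    refine DFL.tendsto_integral_of_norm_le_const ((R + R) ^ 2)
      (fun k => (((ma k 1).1.sub hx.aestronglyMeasurable).norm.pow 2)) (fun k => ?_) ?_
    · filter_upwards [xbox] with ω h
      rw [norm_pow, norm_norm]
      exact pow_le_pow_left₀ (norm_nonneg _)
        ((norm_sub_le _ _).trans (add_le_add (hR _ (abox k ω)) (hR _ h))) 2
    · filter_upwards [hlim] with ω h
      simpa using ((h.1.sub_const (x ω)).norm).pow 2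
  · exact DFL.tendsto_integral_of_norm_le_const R (fun k => (ma k 1).1)
      (fun k => .of_forall fun ω => hR _ (abox k ω)) (hlim.mono fun ω h => h.1)
  · exact tendsto_pi_nhds.2 fun i => DFL.tendsto_integral_of_norm_le_const R
      (fun k => (mw k i 1).1) (fun k => .of_forall fun ω => hR _ (wbox k i ω))
      (hlim.mono fun ω h => (h.2 i).1)
  · exact tendsto_pi_nhds.2 fun i => DFL.tendsto_integral_of_norm_le_const R
      (fun k => (mv k i 1).1) (fun k => .of_forall fun ω => hR _ (vbox k i ω))
      (hlim.mono fun ω h => (h.2 i).2)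
  · intro η C E hη
    have inv_lim : ∀ c : ℝ, 1 < c → Tendsto (fun k : ℕ => (c ^ k)⁻¹) atTop (𝓝 0) := fun c hc =>
      tendsto_inv_atTop_zero.comp (tendsto_pow_atTop_atTop_of_one_lt hc)
    have h1 := (merit_lim.add ((inv_lim γ hγ).const_mul C)).add ((inv_lim η hη).const_mul E)
    rw [mul_zero, mul_zero, add_zero, add_zero] at h1
    exact h1
  · exact DFL.tendsto_integral_of_norm_le_const Cg (fun k => (mg k).1)
      (fun k => .of_forall fun ω => hCg _ (abox k ω))
      (hlim.mono fun ω h => (cg.tendsto _).comp h.1)
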